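/- Let $S^3$ be the group of unit quaternions with its round metric, its surface measure $dx$, geodesic distance $\alpha(x,y)\in[0,\pi]$, and the orientation in which $i,j,k$ is a positive basis of the tangent space at $1$. For $x,y\in S^3$ let $L_{yx^{-1}}v=yx^{-1}v$ be the left translation that carries tangent vectors at $x$ to tangent vectors at $y$. Let $V$ be a smooth tangent vector field on $S^3$. For a kernel $\varphi$, a function of the distance, write $\varphi(x,y)=\varphi(\alpha(x,y))$ and put $$A(V,\varphi)(y)=\int_{S^3}L_{yx^{-1}}V(x)\,\varphi(x,y)\,dx,\qquad B(V,\varphi)(y)=\int_{S^3}L_{yx^{-1}}V(x)\times\nabla_y\varphi(x,y)\,dx,$$ $$g(V,\varphi)(y)=\int_{S^3}L_{yx^{-1}}V(x)\cdot\nabla_y\varphi(x,y)\,dx,\qquad G(V,\varphi)=\nabla g(V,\varphi).$$ These are extended linearly to kernels $\psi+c\,\delta$, where $\delta$ is the Dirac function of the diagonal: $A(V,\delta)=V$, and in $B$ and $g$ the field $\nabla_y\delta(x,y)$ is the distribution in $x$ with $\int W(x)\,\nabla_y\delta(x,y)\,dx=\nabla W(y)$. Let $\varphi$ be three times continuously differentiable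 on $(0,\pi)$ with $|\varphi(\alpha)|\le C/\alpha$, $|\varphi'(\alpha)|\le C/\alpha^2$ there, and suppose that $\psi(\alpha)=\frac{1}{\sin^2\alpha}\frac{d}{d\alpha}\bigl(\sin^2\alpha\,\frac{d\varphi}{d\alpha}\bigr)$ satisfies $|\psi|\le C/\sin\alpha$, $|\psi'|\le C/\sin^2\alpha$ on $(0,\pi)$, for some constant $C$. Then there is a real number $c$ such that the Laplacian of the kernel in the sense of distributions is $\Delta\varphi=\psi+c\,\delta$, that is, $$\int_{S^3}\varphi(x,y)\,\Delta f(x)\,dx=\int_{S^3}\psi(x,y)f(x)\,dx+c\,f(y)\qquad\text{for all } f\in C^\infty(S^3),\ y\in S^3,$$ and $c=0$ if $\alpha^2\varphi'(\alpha)\to0$ as $\alpha\to0^+$ (in particular if the kernel is smooth). The vector fields $A(V,\varphi)$, $B(V,\varphi)$ and the functions $g(V,\varphi)$, $g(V,\Delta\varphi)$ are smooth, and, with the vector Laplacian $\Delta W=-\nabla\times\nabla\times W+\nabla(\nabla\cdot W)$, $$\Delta A(V,\varphi)=A(V,\Delta\varphi)-4A(V,\varphi)-2B(V,\varphi),$$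 $$\Delta B(V,\varphi)=B(V,\Delta\varphi)+2A(V,\Delta\varphi)-2G(V,\varphi),$$ $$\Delta G(V,\varphi)=G(V,\Delta\varphi).$$ -/

import Mathlib

open Set Filter Topology MeasureTheory
open scoped Manifold ContDiff Quaternion

noncomputable section

namespace SphereConv

/-- The Borel sigma-algebra on the quaternions. -/
instance instMeasurableSpaceQuaternion : MeasurableSpace ℍ[ℝ] := borel _

instance instBorelSpaceQuaternion : BorelSpace ℍ[ℝ] := ⟨rfl⟩

instance instFactFinrank : Fact (Module.finrank ℝ ℍ[ℝ] = 3 + 1) :=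
  ⟨Quaternion.finrank_eq_four⟩

/-- The 3-sphere: the unit quaternions, with the manifold structure that Mathlib gives to the
unit sphere of a 4-dimensional inner product space. -/
abbrev S3 : Type := Metric.sphere (0 : ℍ[ℝ]) 1

/-- The Riemannian (surface) measure of the unit 3-sphere, of total mass `2 * π ^ 2`. -/
def surf : Measure S3 := (volume : Measure ℍ[ℝ]).toSphere

/-- Smooth maps from the 3-sphere to a normed space. -/
def Smooth {E : Type*} [NormedAddCommGroup E] [NormedSpace ℝ E] (F : S3 → E) : Prop :=
  ContMDiff (𝓡 3) 𝓘(ℝ, E) ∞ F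

/-- A smooth tangent vector field on the 3-sphere; the tangent space at `x` is the orthogonal
complement of `x` in the quaternions. -/
structure IsSmoothField (V : S3 → ℍ[ℝ]) : Prop where
  smooth : Smooth V
  tangent : ∀ x : S3, inner ℝ (x : ℍ[ℝ]) (V x) = 0

open Classical in
/-- Radial projection of the nonzero quaternions to the 3-sphere (`0` is sent to `1`). -/
def proj (z : ℍ[ℝ]) : S3 :=
  if h : z = 0 then ⟨1, by simp⟩
  else ⟨(‖z‖⁻¹ : ℝ) • z, by simp [norm_smul, h]⟩

/-- Directional derivative at `y` of a map on the 3-sphere, in the direction of the tangent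
vector `v` at `y`: the derivative of its radially constant extension. -/
def tderiv {E : Type*} [NormedAddCommGroup E] [NormedSpace ℝ E] (F : S3 → E) (y : S3)
    (v : ℍ[ℝ]) : E :=
  fderiv ℝ (fun z : ℍ[ℝ] => F (proj z)) (y : ℍ[ℝ]) v

/-- The units `i`, `j`, `k`. -/
def unit3 : Fin 3 → ℍ[ℝ] := ![⟨0, 1, 0, 0⟩, ⟨0, 0, 1, 0⟩, ⟨0, 0, 0, 1⟩]

/-- The positively oriented orthonormal basis `y i`, `y j`, `y k` of the tangent space at `y`. -/
def frame (a : Fin 3) (y : S3) : ℍ[ℝ] := (y : ℍ[ℝ]) * unit3 a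

/-- The cross product of tangent vectors at `y`, for the orientation in which `i, j, k` is a
positive basis of the tangent space at `1`. Left multiplication by the inverse of `y` is an
orientation-preserving isometry that takes the tangent space at `y` to the imaginary quaternions,
where the cross product is the imaginary part of the quaternion product. -/
def cross (y : S3) (v w : ℍ[ℝ]) : ℍ[ℝ] :=
  (y : ℍ[ℝ]) * (((y : ℍ[ℝ])⁻¹ * v) * ((y : ℍ[ℝ])⁻¹ * w)).im

/-- The gradient of a function. -/
def grad (f : S3 → ℝ) (y : S3) : ℍ[ℝ] :=
  ∑ a : Fin 3, tderiv f y (frame a y) • frame a y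

/-- The Levi-Civita covariant derivative of a tangent field `V` at `y` in the direction `v`:
the tangential part of the derivative in the ambient space. -/
def covDeriv (V : S3 → ℍ[ℝ]) (y : S3) (v : ℍ[ℝ]) : ℍ[ℝ] :=
  tderiv V y v - (inner ℝ (y : ℍ[ℝ]) (tderiv V y v) : ℝ) • (y : ℍ[ℝ])

/-- The divergence of a tangent field. -/
def divg (V : S3 → ℍ[ℝ]) (y : S3) : ℝ :=
  ∑ a : Fin 3, inner ℝ (frame a y) (covDeriv V y (frame a y))

/-- The curl of a tangent field. -/
def curl (V : S3 → ℍ[ℝ]) (y : S3) : ℍ[ℝ] :=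
  ∑ a : Fin 3, cross y (frame a y) (covDeriv V y (frame a y))

/-- The scalar Laplacian, the divergence of the gradient. -/
def lap (f : S3 → ℝ) (y : S3) : ℝ := divg (grad f) y

/-- The vector Laplacian, `- curl curl + grad div`. -/
def vlap (V : S3 → ℍ[ℝ]) (y : S3) : ℍ[ℝ] := - curl (curl V) y + grad (divg V) y

/-- The geodesic distance on the 3-sphere, with values in `[0, π]`. -/
def ang (x y : S3) : ℝ := Real.arccos (inner ℝ (x : ℍ[ℝ]) (y : ℍ[ℝ]))

/-- The left translation `L_{y x⁻¹}` that carries a tangent vector `v` at `x` to one at `y`. -/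
def transl (x y : S3) (v : ℍ[ℝ]) : ℍ[ℝ] := (y : ℍ[ℝ]) * (x : ℍ[ℝ])⁻¹ * v

/-- A kernel `fn(α) + mass · δ`, where `α` is the geodesic distance of two points and `δ` is the
Dirac function of the diagonal. Only the values of `fn` on `(0, π)` matter. -/
structure Kernel where
  fn : ℝ → ℝ
  mass : ℝ

/-- A function of the geodesic distance as a kernel. -/
def Kernel.ofFun (φ : ℝ → ℝ) : Kernel := ⟨φ, 0⟩

/-- `∫ f(x) K(x, y) dx` for a scalar function `f`. -/
def pair (K : Kernel) (f : S3 → ℝ) (y : S3) : ℝ :=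
  (∫ x, K.fn (ang x y) * f x ∂surf) + K.mass * f y

/-- `K'` is the Laplacian of `K` in the sense of distributions. -/
def IsLaplacian (K K' : Kernel) : Prop :=
  ∀ f : S3 → ℝ, Smooth f → ∀ y : S3, pair K (lap f) y = pair K' f y

/-- The Laplacian of a function of the geodesic distance, at distances `0 < α < π`. -/
def radLap (φ : ℝ → ℝ) (α : ℝ) : ℝ :=
  1 / Real.sin α ^ 2 * deriv (fun t => Real.sin t ^ 2 * deriv φ t) α

/-- `A(V, K)(y) = ∫ L_{y x⁻¹} V(x) K(x, y) dx`. -/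
def convA (V : S3 → ℍ[ℝ]) (K : Kernel) (y : S3) : ℍ[ℝ] :=
  (∫ x, K.fn (ang x y) • transl x y (V x) ∂surf) + K.mass • V y

/-- `B(V, K)(y) = ∫ L_{y x⁻¹} V(x) × ∇_y K(x, y) dx`. For fixed `y` the field `∇_y δ(x, y)` is the
distribution in `x` for which `∫ W(x) ∇_y δ(x, y) dx` is the gradient of `W` at `y`; it is paired
here with `W(x) = L_{y x⁻¹} V(x)`, which takes its values in the tangent space at `y`. -/
def convB (V : S3 → ℍ[ℝ]) (K : Kernel) (y : S3) : ℍ[ℝ] :=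
  (∫ x, cross y (transl x y (V x)) (grad (fun z => K.fn (ang x z)) y) ∂surf) +
    K.mass • ∑ a : Fin 3,
      cross y (tderiv (fun x => transl x y (V x)) y (frame a y)) (frame a y)

/-- `g(V, K)(y) = ∫ L_{y x⁻¹} V(x) · ∇_y K(x, y) dx`, where `∇_y δ(x, y)` is understood as in the
convolution of type `B`. -/
def convg (V : S3 → ℍ[ℝ]) (K : Kernel) (y : S3) : ℝ :=
  (∫ x, inner ℝ (transl x y (V x)) (grad (fun z => K.fn (ang x z)) y) ∂surf) +
    K.mass * ∑ a : Fin 3,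
      inner ℝ (tderiv (fun x => transl x y (V x)) y (frame a y)) (frame a y)

/-- `G(V, K) = ∇ g(V, K)`. -/
def convG (V : S3 → ℍ[ℝ]) (K : Kernel) (y : S3) : ℍ[ℝ] := grad (convg V K) y

/-- The kernel functions: functions of the distance `α`, three times continuously differentiable
for `0 < α < π`, with a singularity of order at most `1 / α` at `α = 0`, such that the same holds
for the Laplacian, where a singularity of that order is also allowed at `α = π`. -/
structure IsKernelFun (φ : ℝ → ℝ) : Prop where
  contDiff : ContDiffOn ℝ 3 φ (Ioo 0 Real.pi)
  bound : ∃ C : ℝ, ∀ α ∈ Ioo 0 Real.pi, |φ α| ≤ C / α ∧ |deriv φ α| ≤ C / α ^ 2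
  bound_lap : ∃ C : ℝ, ∀ α ∈ Ioo 0 Real.pi,
    |radLap φ α| ≤ C / Real.sin α ∧ |deriv (radLap φ) α| ≤ C / Real.sin α ^ 2

end SphereConv

end

/-! Write E_a for the left-invariant fields `frame a`. Left translation carries E_a at x to E_a at
y, so in this frame everything reduces to scalar convolutions: with V_a = `comp V a` and w_a = φ *
V_a, the field A(V, φ) has the components w_a (`convA_eq`). The distance is invariant under right
translations, so (φ * f)(y) = ∫ φ(α(x, 1)) f(xy) dx, where y enters only through the smooth factor.
Hence φ * f is smooth, and convolution commutes with the E_a, which generate right translations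
(`IsC1Kernel.lder_conv`). Integration by parts moves ∇_y φ onto V and gives B the components -rot w
and g = Σ E_a w_a (`convB_eq`, `convg_eq`).

The rest of the geometry is the Lie algebra: [E_0, E_1] = 2 E_2 and its cyclic permutations, and
∇_{E_b} E_a = E_b × E_a. They give curl = rot - 2 and rot rot w = grad div w + 2 rot w - Σ E_b² w,
so the vector Laplacian is Σ E_b² + 2 rot - 4 on components (`vlap_fld`). Since the Casimir operator
Σ E_b² commutes with every E_a (`slap_lder`), the three identities follow from Σ E_b² (φ * f) = ψ *
f + c f.

That scalar identity (`IsKernelFun.conv_slap`) is Green's formula around the singular points y and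
-y. The divergence theorem `integral_div_eq_zero` holds for fields that are o(1/sin² α) there. At -y
the derivative φ' is bounded, so nothing is lost. At y only α² φ' = O(1) is known, so the formula is
applied to f - f(y); the constant f(y) then contributes c = -∫ ψ. If α² φ' → 0, the test function 1
is admissible itself and yields c = 0. -/

noncomputable section

namespace SphereConv

/-! ### Calculus on the sphere through radially constant extensions and left-invariant fields. -/

section Calculus

variable {E : Type*} [NormedAddCommGroup E] [NormedSpace ℝ E]

lemma norm_coe (x : S3) : ‖(x : ℍ[ℝ])‖ = 1 := by simp

lemma coe_ne_zero (x : S3) : (x : ℍ[ℝ]) ≠ 0 := by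
  intro h; have := norm_coe x; simp [h] at this

lemma coe_proj {z : ℍ[ℝ]} (hz : z ≠ 0) : (proj z : ℍ[ℝ]) = ‖z‖⁻¹ • z := by
  simp [proj, hz]

@[simp] lemma proj_coe (x : S3) : proj (x : ℍ[ℝ]) = x := by
  ext1; rw [coe_proj (coe_ne_zero x)]; simp

lemma proj_smul {r : ℝ} (hr : 0 < r) (z : ℍ[ℝ]) : proj (r • z) = proj z := by
  by_cases hz : z = 0
  · simp [hz]
  · ext1
    rw [coe_proj hz, coe_proj (smul_ne_zero hr.ne' hz), norm_smul, Real.norm_of_nonneg hr.le,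
      smul_smul, mul_inv]
    congr 1; field_simp

lemma proj_coe_mul (x : S3) {z : ℍ[ℝ]} (hz : z ≠ 0) : proj (x * z) = x * proj z := by
  ext1
  rw [Metric.unitSphere.coe_mul, coe_proj hz, coe_proj (mul_ne_zero (coe_ne_zero x) hz)]
  simp

lemma contDiffAt_coe_proj {n : ℕ∞ω} {z : ℍ[ℝ]} (hz : z ≠ 0) :
    ContDiffAt ℝ n (fun z => (proj z : ℍ[ℝ])) z := by
  have h : (fun z => (proj z : ℍ[ℝ])) =ᶠ[𝓝 z] fun z => ‖z‖⁻¹ • z := by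
    filter_upwards [isOpen_ne.mem_nhds hz] with w hw using coe_proj hw
  exact (((contDiffAt_norm ℝ hz).inv (norm_ne_zero_iff.2 hz)).smul
    contDiffAt_id).congr_of_eventuallyEq h

/-- A map on the 3-sphere is of class `C^n` at `x`: so is its radially constant extension. -/
def RegAt (n : ℕ∞ω) (f : S3 → E) (x : S3) : Prop :=
  ContDiffAt ℝ n (fun z : ℍ[ℝ] => f (proj z)) x

lemma RegAt.contDiffAt {n : ℕ∞ω} {f : S3 → E} {z : ℍ[ℝ]} (h : RegAt n f (proj z)) (hz : z ≠ 0) :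
    ContDiffAt ℝ n (fun z : ℍ[ℝ] => f (proj z)) z := by
  have := ContDiffAt.comp z (g := fun z : ℍ[ℝ] => f (proj z)) (f := fun z => (proj z : ℍ[ℝ])) h
    (contDiffAt_coe_proj hz)
  simpa [Function.comp_def] using this

lemma regAt_comp_coe {n : ℕ∞ω} {G : ℍ[ℝ] → E} {x : S3} (h : ContDiffAt ℝ n G x) :
    RegAt n (fun x : S3 => G x) x :=
  ContDiffAt.comp (x : ℍ[ℝ]) (g := G) (by simpa using h) (contDiffAt_coe_proj (coe_ne_zero x))

lemma contMDiffAt_proj {n : ℕ∞ω} {z : ℍ[ℝ]} (hz : z ≠ 0) :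
    ContMDiffAt 𝓘(ℝ, ℍ[ℝ]) (𝓡 3) n proj z := by
  let U : TopologicalSpace.Opens ℍ[ℝ] := ⟨{0}ᶜ, isOpen_compl_singleton⟩
  have h1 : ContMDiff 𝓘(ℝ, ℍ[ℝ]) 𝓘(ℝ, ℍ[ℝ]) n (fun w : U => (proj w : ℍ[ℝ])) := fun w =>
    (contDiffAt_coe_proj w.2).contMDiffAt.comp w (contMDiff_subtype_val w)
  have h2 : ContMDiff 𝓘(ℝ, ℍ[ℝ]) (𝓡 3) n (fun w : U => proj w) :=
    h1.codRestrict_sphere (fun w => (proj w).2)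
  exact contMDiffAt_subtype_iff.1 (h2 ⟨z, hz⟩)

/-- The inclusion and `proj` are smooth and compose to the identity of the sphere, so smoothness in
charts can be tested on the extension to the ambient space. -/
lemma smooth_iff {f : S3 → E} : Smooth f ↔ ∀ x, RegAt ∞ f x := by
  constructor
  · intro h x
    refine ContMDiffAt.contDiffAt ?_
    exact ContMDiffAt.comp (x : ℍ[ℝ]) (h _) (contMDiffAt_proj (coe_ne_zero x))
  · intro h x
    have := ContMDiffAt.comp x (h x).contMDiffAt (contMDiff_coe_sphere (n := 3) x)
    simpa [Function.comp_def] using this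

lemma RegAt.continuousAt {n : ℕ∞ω} {f : S3 → E} {x : S3} (h : RegAt n f x) :
    ContinuousAt f x := by
  have := ContinuousAt.comp (f := fun x : S3 => (x : ℍ[ℝ])) (x := x) (ContDiffAt.continuousAt h)
    continuous_subtype_val.continuousAt
  simpa [Function.comp_def] using this

lemma RegAt.of_le {m n : ℕ∞ω} {f : S3 → E} {x : S3} (h : RegAt n f x) (hmn : m ≤ n) :
    RegAt m f x := ContDiffAt.of_le h hmn

lemma continuousAt_proj {z : ℍ[ℝ]} (hz : z ≠ 0) : ContinuousAt proj z :=
  (contMDiffAt_proj (n := 0) hz).continuousAt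

lemma continuous_of_regAt {n : ℕ∞ω} {f : S3 → E} (h : ∀ x, RegAt n f x) : Continuous f :=
  continuous_iff_continuousAt.2 fun x => (h x).continuousAt

lemma RegAt.congr_of_eventuallyEq {n : ℕ∞ω} {f g : S3 → E} {x : S3} (h : RegAt n f x)
    (hg : g =ᶠ[𝓝 x] f) : RegAt n g x := by
  refine ContDiffAt.congr_of_eventuallyEq h ?_
  have : Tendsto proj (𝓝 (x : ℍ[ℝ])) (𝓝 x) := by
    simpa [ContinuousAt] using continuousAt_proj (coe_ne_zero x)
  exact this.eventually hg

lemma regAt_const {n : ℕ∞ω} (c : E) (x : S3) : RegAt n (fun _ => c) x := contDiffAt_const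

lemma regAt_frame {n : ℕ∞ω} (a : Fin 3) (x : S3) : RegAt n (frame a) x :=
  regAt_comp_coe (G := fun z => z * unit3 a) (contDiffAt_id.mul contDiffAt_const)

section Reg
variable {n : ℕ∞ω} {x : S3}

lemma RegAt.add {f g : S3 → E} (hf : RegAt n f x) (hg : RegAt n g x) :
    RegAt n (fun x => f x + g x) x := ContDiffAt.add hf hg

lemma RegAt.sub {f g : S3 → E} (hf : RegAt n f x) (hg : RegAt n g x) :
    RegAt n (fun x => f x - g x) x := ContDiffAt.sub hf hg

lemma RegAt.neg {f : S3 → E} (hf : RegAt n f x) : RegAt n (fun x => - f x) x := ContDiffAt.neg hf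

lemma RegAt.smul {f : S3 → ℝ} {g : S3 → E} (hf : RegAt n f x) (hg : RegAt n g x) :
    RegAt n (fun x => f x • g x) x := ContDiffAt.smul hf hg

lemma RegAt.mul {f g : S3 → ℝ} (hf : RegAt n f x) (hg : RegAt n g x) :
    RegAt n (fun x => f x * g x) x := ContDiffAt.mul hf hg

lemma RegAt.inner {f g : S3 → ℍ[ℝ]} (hf : RegAt n f x) (hg : RegAt n g x) :
    RegAt n (fun x => (inner ℝ (f x) (g x) : ℝ)) x := ContDiffAt.inner ℝ hf hg

lemma RegAt.sum {ι : Type*} {s : Finset ι} {f : ι → S3 → E} (h : ∀ i ∈ s, RegAt n (f i) x) :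
    RegAt n (fun x => ∑ i ∈ s, f i x) x :=
  ContDiffAt.sum (f := fun i z => f i (proj z)) h

lemma RegAt.comp {q : ℝ → ℝ} {f : S3 → ℝ} (hq : ContDiffAt ℝ n q (f x)) (hf : RegAt n f x) :
    RegAt n (fun x => q (f x)) x :=
  ContDiffAt.comp (x : ℍ[ℝ]) (g := q) (by simpa using hq) hf

end Reg

/-- The derivative of a map along the left-invariant field `frame b`. -/
def lder (b : Fin 3) (f : S3 → E) (y : S3) : E := tderiv f y (frame b y)

lemma fderiv_comp_proj_smul (f : S3 → E) {r : ℝ} (hr : 0 < r) (z v : ℍ[ℝ]) :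
    fderiv ℝ (fun z : ℍ[ℝ] => f (proj z)) (r • z) (r • v) =
      fderiv ℝ (fun z : ℍ[ℝ] => f (proj z)) z v := by
  have h := fderiv_comp_smul (𝕜 := ℝ) (f := fun z : ℍ[ℝ] => f (proj z)) (x := z) r
  simp only [proj_smul hr] at h
  conv_rhs => rw [h]
  simp

/-- The extension is homogeneous of degree 0, so its derivative has degree -1, and the linear field
z ↦ z * `unit3 b` of degree 1 compensates. The formula off the sphere is what allows `lder b f` to
be differentiated again. -/
lemma lder_proj (b : Fin 3) (f : S3 → E) {z : ℍ[ℝ]} (hz : z ≠ 0) :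
    lder b f (proj z) = fderiv ℝ (fun z : ℍ[ℝ] => f (proj z)) z (z * unit3 b) := by
  have hr : 0 < ‖z‖⁻¹ := inv_pos.2 (norm_pos_iff.2 hz)
  rw [← fderiv_comp_proj_smul f hr, lder, tderiv, frame, coe_proj hz, smul_mul_assoc]

lemma RegAt.lder {n : ℕ∞ω} {f : S3 → E} {x : S3} (h : RegAt (n + 1) f x) (b : Fin 3) :
    RegAt n (SphereConv.lder b f) x := by
  have h1 : ContDiffAt ℝ n (fun z : ℍ[ℝ] =>
      fderiv ℝ (fun z : ℍ[ℝ] => f (proj z)) z (z * unit3 b)) x :=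
    (ContDiffAt.fderiv_right h le_rfl).clm_apply (contDiffAt_id.mul contDiffAt_const)
  refine h1.congr_of_eventuallyEq ?_
  filter_upwards [isOpen_ne.mem_nhds (coe_ne_zero x)] with z hz using lder_proj b f hz

lemma RegAt.lder_infty {f : S3 → E} {x : S3} (h : RegAt ∞ f x) (b : Fin 3) :
    RegAt ∞ (SphereConv.lder b f) x := RegAt.lder (n := ∞) (by simpa using h) b

@[simp] lemma re_unit3 (b : Fin 3) : (unit3 b).re = 0 := by fin_cases b <;> rfl
@[simp] lemma imI_unit3 (b : Fin 3) : (unit3 b).imI = ![1, 0, 0] b := by fin_cases b <;> rfl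
@[simp] lemma imJ_unit3 (b : Fin 3) : (unit3 b).imJ = ![0, 1, 0] b := by fin_cases b <;> rfl
@[simp] lemma imK_unit3 (b : Fin 3) : (unit3 b).imK = ![0, 0, 1] b := by fin_cases b <;> rfl

lemma unit3_mul_self (b : Fin 3) : unit3 b * unit3 b = -1 := by
  ext <;> fin_cases b <;> simp

lemma norm_unit3 (b : Fin 3) : ‖unit3 b‖ = 1 := by
  have : ‖unit3 b * unit3 b‖ = 1 := by rw [unit3_mul_self]; simp
  rw [norm_mul] at this
  nlinarith [norm_nonneg (unit3 b)]

lemma inner_one_unit3 (b : Fin 3) : inner ℝ (1 : ℍ[ℝ]) (unit3 b) = (0 : ℝ) := by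
  simp [Quaternion.inner_def]

/-- The one-parameter subgroup generated by `unit3 b`. -/
def flow (b : Fin 3) (t : ℝ) : S3 :=
  ⟨(Real.cos t) • 1 + Real.sin t • unit3 b, by
    have h := norm_add_sq_real ((Real.cos t) • (1 : ℍ[ℝ])) (Real.sin t • unit3 b)
    rw [inner_smul_left, inner_smul_right, inner_one_unit3, norm_smul, norm_smul,
      norm_unit3] at h
    simp only [Real.norm_eq_abs, norm_one, mul_one, sq_abs, mul_zero, add_zero,
      Real.cos_sq_add_sin_sq] at h
    rw [mem_sphere_zero_iff_norm]
    nlinarith [norm_nonneg ((Real.cos t) • (1 : ℍ[ℝ]) + Real.sin t • unit3 b)]⟩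

lemma coe_flow (b : Fin 3) (t : ℝ) :
    (flow b t : ℍ[ℝ]) = (Real.cos t) • 1 + Real.sin t • unit3 b := rfl

@[simp] lemma flow_zero (b : Fin 3) : flow b 0 = 1 := by
  ext1; rw [coe_flow]; simp

lemma hasDerivAt_coe_flow (b : Fin 3) (t : ℝ) :
    HasDerivAt (fun t => (flow b t : ℍ[ℝ])) (flow b t * unit3 b) t := by
  have h := ((Real.hasDerivAt_cos t).smul_const (1 : ℍ[ℝ])).add
    ((Real.hasDerivAt_sin t).smul_const (unit3 b))
  refine h.congr_deriv ?_
  rw [coe_flow, add_mul, smul_mul_assoc, smul_mul_assoc, unit3_mul_self]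
  simp [add_comm]

lemma hasDerivAt_mul_flow (x : S3) (b : Fin 3) (t : ℝ) :
    HasDerivAt (fun t => ((x * flow b t : S3) : ℍ[ℝ])) (frame b (x * flow b t)) t := by
  have := (hasDerivAt_coe_flow b t).const_mul (x : ℍ[ℝ])
  simpa [frame, mul_assoc] using this

lemma RegAt.hasDerivAt_flow {n : ℕ∞ω} (hn : n ≠ 0) {f : S3 → E} {x : S3} {b : Fin 3} {t : ℝ}
    (h : RegAt n f (x * flow b t)) :
    HasDerivAt (fun t => f (x * flow b t)) (SphereConv.lder b f (x * flow b t)) t := by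
  have h1 := (ContDiffAt.differentiableAt h hn).hasFDerivAt.comp_hasDerivAt t
    (hasDerivAt_mul_flow x b t)
  simpa only [Function.comp_def, proj_coe, SphereConv.lder, tderiv] using h1

lemma RegAt.hasDerivAt_flow_zero {n : ℕ∞ω} (hn : n ≠ 0) {f : S3 → E} {x : S3}
    (h : RegAt n f x) (b : Fin 3) :
    HasDerivAt (fun t => f (x * flow b t)) (SphereConv.lder b f x) 0 := by
  simpa using RegAt.hasDerivAt_flow hn (f := f) (x := x) (b := b) (t := 0) (by simpa using h)

/-- Reduces the rules below to one-variable derivatives along the curve t ↦ x * `flow b t`. -/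
lemma RegAt.lder_eq {n : ℕ∞ω} (hn : n ≠ 0) {f : S3 → E} {x : S3}
    (h : RegAt n f x) {b : Fin 3} {c : E} (hc : HasDerivAt (fun t => f (x * flow b t)) c 0) :
    SphereConv.lder b f x = c :=
  (h.hasDerivAt_flow_zero hn b).unique hc

section Rules
variable {n : ℕ∞ω} {x : S3} (b : Fin 3)

lemma lder_const (c : E) : lder b (fun _ => c) x = 0 :=
  (regAt_const (n := 1) c x).lder_eq one_ne_zero (hasDerivAt_const _ _)

lemma lder_add (hn : n ≠ 0) {f g : S3 → E} (hf : RegAt n f x) (hg : RegAt n g x) :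
    lder b (fun x => f x + g x) x = lder b f x + lder b g x :=
  (hf.add hg).lder_eq hn ((hf.hasDerivAt_flow_zero hn b).add (hg.hasDerivAt_flow_zero hn b))

lemma lder_sub (hn : n ≠ 0) {f g : S3 → E} (hf : RegAt n f x) (hg : RegAt n g x) :
    lder b (fun x => f x - g x) x = lder b f x - lder b g x :=
  (hf.sub hg).lder_eq hn ((hf.hasDerivAt_flow_zero hn b).sub (hg.hasDerivAt_flow_zero hn b))

lemma lder_neg (hn : n ≠ 0) {f : S3 → E} (hf : RegAt n f x) :
    lder b (fun x => - f x) x = - lder b f x :=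
  hf.neg.lder_eq hn (hf.hasDerivAt_flow_zero hn b).neg

lemma lder_sum (hn : n ≠ 0) {ι : Type*} {s : Finset ι} {f : ι → S3 → E}
    (h : ∀ i ∈ s, RegAt n (f i) x) :
    lder b (fun x => ∑ i ∈ s, f i x) x = ∑ i ∈ s, lder b (f i) x :=
  (RegAt.sum h).lder_eq hn (HasDerivAt.fun_sum fun i hi => (h i hi).hasDerivAt_flow_zero hn b)

lemma lder_smul (hn : n ≠ 0) {f : S3 → ℝ} {g : S3 → E} (hf : RegAt n f x) (hg : RegAt n g x) :
    lder b (fun x => f x • g x) x = f x • lder b g x + lder b f x • g x := by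
  refine (hf.smul hg).lder_eq hn ?_
  simpa using (hf.hasDerivAt_flow_zero hn b).fun_smul (hg.hasDerivAt_flow_zero hn b)

lemma lder_mul (hn : n ≠ 0) {f g : S3 → ℝ} (hf : RegAt n f x) (hg : RegAt n g x) :
    lder b (fun x => f x * g x) x = f x * lder b g x + lder b f x * g x :=
  lder_smul b hn hf hg

lemma lder_comp (hn : n ≠ 0) {q : ℝ → ℝ} {q' : ℝ} {f : S3 → ℝ} (hq : ContDiffAt ℝ n q (f x))
    (hq' : HasDerivAt q q' (f x)) (hf : RegAt n f x) :
    lder b (fun x => q (f x)) x = q' * lder b f x := by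
  refine (hf.comp hq).lder_eq hn ?_
  have := HasDerivAt.comp (h₂ := q) (h := fun t => f (x * flow b t)) (h₂' := q') 0
    (by simpa using hq')
    (hf.hasDerivAt_flow_zero hn b)
  exact this

lemma lder_frame (a : Fin 3) : lder b (frame a) x = x * (unit3 b * unit3 a) := by
  refine (regAt_frame (n := 1) a x).lder_eq one_ne_zero ?_
  have := (hasDerivAt_mul_flow x b 0).mul_const (unit3 a)
  simpa [frame, mul_assoc] using this

end Rules

lemma lder_congr {f g : S3 → E} {x : S3} (h : f =ᶠ[𝓝 x] g) (b : Fin 3) :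
    lder b f x = lder b g x := by
  have : Tendsto proj (𝓝 (x : ℍ[ℝ])) (𝓝 x) := by
    simpa [ContinuousAt] using continuousAt_proj (coe_ne_zero x)
  rw [lder, lder, tderiv, tderiv,
    Filter.EventuallyEq.fderiv_eq (this.eventually (p := fun y => f y = g y) h)]

/-- The commutator of two left-invariant fields. -/
lemma lder_lder_sub {f : S3 → E} {x : S3} (h : RegAt 2 f x) (a b : Fin 3) :
    lder a (lder b f) x - lder b (lder a f) x =
      tderiv f x (x * (unit3 a * unit3 b - unit3 b * unit3 a)) := by
  set F : ℍ[ℝ] → E := fun z => f (proj z) with hF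
  have hF2 : ContDiffAt ℝ 2 F x := h
  -- The second derivative of F is symmetric and drops out of the commutator; what remains comes
  -- from differentiating the linear field z ↦ z * `unit3 b`.
  have key : ∀ a b : Fin 3, lder a (lder b f) x =
      fderiv ℝ (fderiv ℝ F) x (frame a x) (frame b x) + fderiv ℝ F x (frame a x * unit3 b) := by
    intro a b
    have h1 : (fun z => lder b f (proj z)) =ᶠ[𝓝 (x : ℍ[ℝ])]
        fun z => fderiv ℝ F z (z * unit3 b) := by
      filter_upwards [isOpen_ne.mem_nhds (coe_ne_zero x)] with z hz using lder_proj b f hz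
    have h2 : HasFDerivAt (fderiv ℝ F) (fderiv ℝ (fderiv ℝ F) x) (x : ℍ[ℝ]) :=
      ((hF2.fderiv_right (m := 1) (by norm_num)).differentiableAt one_ne_zero).hasFDerivAt
    have h3 : HasFDerivAt (fun z : ℍ[ℝ] => z * unit3 b)
        ((ContinuousLinearMap.mul ℝ ℍ[ℝ]).flip (unit3 b)) (x : ℍ[ℝ]) :=
      ((ContinuousLinearMap.mul ℝ ℍ[ℝ]).flip (unit3 b)).hasFDerivAt
    have h4 := h2.clm_apply h3
    rw [lder, tderiv, h1.fderiv_eq, h4.fderiv]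
    simp [frame, add_comm]
  rw [key, key, hF2.isSymmSndFDerivAt (by simp) (frame a x) (frame b x), tderiv, mul_sub, map_sub,
    ← hF]
  simp [frame, mul_assoc]

end Calculus

/-! ### The surface measure: right invariance and integrability of 1 / sin². -/

instance : IsFiniteMeasure surf := inferInstanceAs (IsFiniteMeasure (Measure.toSphere _))

/-- Right multiplication by a unit quaternion as an isometry of the quaternions. -/
def mulRightIso (u : S3) : ℍ[ℝ] ≃ₗᵢ[ℝ] ℍ[ℝ] :=
  LinearIsometry.toLinearIsometryEquiv
    ⟨LinearMap.mulRight ℝ (u : ℍ[ℝ]), fun x => by simp⟩ rfl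

/-- `toSphere` measures a set by the volume of the cone over it, and right multiplication by a unit
is a linear isometry that takes cones to cones. -/
lemma measurePreserving_mul_right_surf (u : S3) :
    MeasurePreserving (fun x : S3 => x * u) surf surf := by
  have hm : Measurable (fun x : S3 => x * u) := (continuous_mul_const u).measurable
  refine ⟨hm, ?_⟩
  ext s hs
  rw [Measure.map_apply hm hs, surf, Measure.toSphere_apply' _ hs,
    Measure.toSphere_apply' _ (hm hs)]
  congr 1
  have hp := (mulRightIso u).measurePreserving
  refine Eq.trans ?_
    (hp.measure_preimage_equiv (f := (mulRightIso u).toHomeomorph.toMeasurableEquiv) _)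
  congr 1
  ext z
  simp only [Set.mem_smul, mem_image, mem_preimage]
  constructor
  · rintro ⟨r, hr, _, ⟨x, hx, rfl⟩, rfl⟩
    exact ⟨r, hr, _, ⟨x * u, hx, rfl⟩, by
      change r • ((x * u : S3) : ℍ[ℝ]) = (r • (x : ℍ[ℝ])) * u
      simp⟩
  · rintro ⟨r, hr, _, ⟨x, hx, rfl⟩, h⟩
    refine ⟨r, hr, _, ⟨x * u⁻¹, by simpa using hx, rfl⟩, ?_⟩
    have hu := coe_ne_zero u
    change r • (x : ℍ[ℝ]) = z * u at h
    simp only [Metric.unitSphere.coe_mul, Metric.unitSphere.coe_inv]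
    rw [← smul_mul_assoc, h, mul_assoc, mul_inv_cancel₀ hu, mul_one]

lemma integral_mul_right_surf {E : Type*} [NormedAddCommGroup E] [NormedSpace ℝ E]
    (f : S3 → E) (u : S3) : ∫ x, f (x * u) ∂surf = ∫ x, f x ∂surf :=
  (measurePreserving_mul_right_surf u).integral_comp
    (Homeomorph.mulRight u).measurableEmbedding f

/-- The cosine of the distance to `y`. -/
def tau (y x : S3) : ℝ := inner ℝ (x : ℍ[ℝ]) (y : ℍ[ℝ])

lemma ang_eq (x y : S3) : ang x y = Real.arccos (tau y x) := rfl

lemma tau_mul_right (y x u : S3) : tau (y * u) (x * u) = tau y x := by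
  simp only [tau, Metric.unitSphere.coe_mul]
  exact (mulRightIso u).inner_map_map _ _

lemma abs_tau_le (y x : S3) : |tau y x| ≤ 1 := by
  have := abs_real_inner_le_norm (x : ℍ[ℝ]) (y : ℍ[ℝ])
  rwa [norm_coe, norm_coe, mul_one] at this

/-- The squared sine of the distance to `y`. -/
def rho (y x : S3) : ℝ := 1 - tau y x ^ 2

lemma rho_nonneg (y x : S3) : 0 ≤ rho y x := by
  have := (sq_le_one_iff_abs_le_one _).2 (abs_tau_le y x)
  unfold rho; linarith

lemma rho_le_one (y x : S3) : rho y x ≤ 1 := by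
  unfold rho; nlinarith [sq_nonneg (tau y x)]

lemma continuous_tau (y : S3) : Continuous (tau y) :=
  continuous_subtype_val.inner continuous_const

lemma continuous_rho (y : S3) : Continuous (rho y) :=
  continuous_const.sub ((continuous_tau y).pow 2)

lemma normSq_coe (x : S3) : (x : ℍ[ℝ]).re ^ 2 + (x : ℍ[ℝ]).imI ^ 2 + (x : ℍ[ℝ]).imJ ^ 2
    + (x : ℍ[ℝ]).imK ^ 2 = 1 := by
  have := Quaternion.normSq_eq_norm_mul_self (x : ℍ[ℝ])
  rw [norm_coe, Quaternion.normSq_def'] at this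
  simpa using this

lemma volume_box_le {ε : ℝ} (hε : 0 ≤ ε) :
    volume {z : ℍ[ℝ] | |z.re| ≤ 1 ∧ |z.imI| ≤ ε ∧ |z.imJ| ≤ ε ∧ |z.imK| ≤ ε} ≤
      ENNReal.ofReal (16 * ε ^ 3) := by
  have h1 := Quaternion.linearIsometryEquivTuple.measurePreserving
  have h2 := (EuclideanSpace.volume_preserving_symm_measurableEquiv_toLp (Fin 4)).comp h1
  have h3 : {z : ℍ[ℝ] | |z.re| ≤ 1 ∧ |z.imI| ≤ ε ∧ |z.imJ| ≤ ε ∧ |z.imK| ≤ ε} =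
      ((MeasurableEquiv.toLp 2 (Fin 4 → ℝ)).symm ∘ Quaternion.linearIsometryEquivTuple) ⁻¹'
        Icc (fun i => -(![1, ε, ε, ε] i)) ![1, ε, ε, ε] := by
    ext z
    have : ((MeasurableEquiv.toLp 2 (Fin 4 → ℝ)).symm ∘ Quaternion.linearIsometryEquivTuple) z
      = ![z.re, z.imI, z.imJ, z.imK] := rfl
    rw [mem_preimage, this, Set.mem_Icc, Pi.le_def, Pi.le_def]
    simp [Fin.forall_fin_succ, abs_le]
    tauto
  rw [h3, h2.measure_preimage measurableSet_Icc.nullMeasurableSet, Real.volume_Icc_pi,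
    Fin.prod_univ_four, ← ENNReal.ofReal_mul (by norm_num),
    ← ENNReal.ofReal_mul (by simp; positivity),
    ← ENNReal.ofReal_mul (by simp; positivity)]
  apply ENNReal.ofReal_le_ofReal
  simp
  nlinarith

-- The set consists of two caps, around y and -y, of size ε in dimension three. Right invariance
-- moves y to 1; the cone over the caps then lies in a box of volume 2 (2ε)³, and `toSphere`
-- multiplies volumes by the dimension 4.
open scoped Pointwise in
lemma surf_rho_le (y : S3) {ε : ℝ} (hε : 0 ≤ ε) :
    surf {x | rho y x ≤ ε ^ 2} ≤ ENNReal.ofReal (64 * ε ^ 3) := by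
  have hcl : MeasurableSet {x | rho y x ≤ ε ^ 2} :=
    (isClosed_le (continuous_rho y) continuous_const).measurableSet
  have hcl1 : MeasurableSet {x | rho 1 x ≤ ε ^ 2} :=
    (isClosed_le (continuous_rho 1) continuous_const).measurableSet
  rw [← (measurePreserving_mul_right_surf y).measure_preimage hcl.nullMeasurableSet]
  have : (fun x : S3 => x * y) ⁻¹' {x | rho y x ≤ ε ^ 2} = {x | rho 1 x ≤ ε ^ 2} := by
    ext x
    have := tau_mul_right 1 x y
    rw [one_mul] at this
    simp [rho, this]
  rw [this, surf, Measure.toSphere_apply' _ hcl1]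
  have hsub : Ioo (0 : ℝ) 1 • ((↑) '' {x : S3 | rho 1 x ≤ ε ^ 2} : Set ℍ[ℝ]) ⊆
      {z : ℍ[ℝ] | |z.re| ≤ 1 ∧ |z.imI| ≤ ε ∧ |z.imJ| ≤ ε ∧ |z.imK| ≤ ε} := by
    rintro _ ⟨r, hr, _, ⟨x, hx, rfl⟩, rfl⟩
    have hn := normSq_coe x
    have ht : tau 1 x = (x : ℍ[ℝ]).re := by simp [tau, Quaternion.inner_def]
    simp only [mem_ofPred_eq, rho, ht] at hx
    have key : ∀ a b : ℝ, 0 ≤ b → a ^ 2 ≤ b ^ 2 → |r * a| ≤ b := by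
      intro a b hb hab
      rw [abs_mul, abs_of_pos hr.1]
      have := abs_le_of_sq_le_sq hab hb
      have h2 : |a| ≤ b := this
      nlinarith [abs_nonneg a, hr.1, hr.2]
    simp only [mem_ofPred_eq, Quaternion.re_smul, Quaternion.imI_smul, Quaternion.imJ_smul,
      Quaternion.imK_smul, smul_eq_mul]
    refine ⟨key _ _ zero_le_one ?_, key _ _ hε ?_, key _ _ hε ?_, key _ _ hε ?_⟩ <;>
    nlinarith [sq_nonneg (x : ℍ[ℝ]).imI, sq_nonneg (x : ℍ[ℝ]).imJ, sq_nonneg (x : ℍ[ℝ]).imK]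
  calc _ ≤ (Module.finrank ℝ ℍ[ℝ] : ENNReal) * ENNReal.ofReal (16 * ε ^ 3) :=
        mul_le_mul_right ((measure_mono hsub).trans (volume_box_le hε)) _
    _ = ENNReal.ofReal (64 * ε ^ 3) := by
        rw [Quaternion.finrank_eq_four, ← ENNReal.ofReal_natCast,
          ← ENNReal.ofReal_mul (by norm_num)]
        congr 1; push_cast; ring

lemma ae_rho_pos (y : S3) : ∀ᵐ x ∂surf, 0 < rho y x := by
  have h := surf_rho_le y le_rfl
  simp only [ne_eq, OfNat.ofNat_ne_zero, not_false_eq_true, zero_pow, mul_zero,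
    ENNReal.ofReal_zero, nonpos_iff_eq_zero] at h
  rw [ae_iff]
  simpa using h

/-- Layer cake: the set where 1 / rho > t has measure at most 64 t^(-3/2), which is integrable for t
> 1; for t ≤ 1 the total mass suffices. -/
lemma integrable_inv_rho (y : S3) : Integrable (fun x => (rho y x)⁻¹) surf := by
  have hm : Measurable (fun x => (rho y x)⁻¹) := (continuous_rho y).measurable.inv
  refine ⟨hm.aestronglyMeasurable, ?_⟩
  have h0 : ∀ x, 0 ≤ (rho y x)⁻¹ := fun x => inv_nonneg.2 (rho_nonneg y x)
  rw [hasFiniteIntegral_iff_ofReal (Eventually.of_forall h0),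
    lintegral_eq_lintegral_meas_lt _ (Eventually.of_forall h0) hm.aemeasurable]
  have hsplit : Ioi (0 : ℝ) = Ioc 0 1 ∪ Ioi 1 := (Ioc_union_Ioi_eq_Ioi zero_le_one).symm
  rw [hsplit]
  refine (lintegral_union_le _ _ _).trans_lt (ENNReal.add_lt_top.2 ⟨?_, ?_⟩)
  · refine lt_of_le_of_lt (lintegral_mono (g := fun _ => surf univ) fun t =>
      measure_mono (subset_univ _)) ?_
    simp [measure_lt_top]
  · have hint : IntegrableOn (fun t : ℝ => 64 * t ^ (-(3 / 2) : ℝ)) (Ioi 1) :=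
      (integrableOn_Ioi_rpow_of_lt (by norm_num) zero_lt_one).const_mul 64
    refine lt_of_le_of_lt (setLIntegral_mono' measurableSet_Ioi
      (g := fun t : ℝ => ENNReal.ofReal (64 * t ^ (-(3 / 2) : ℝ))) fun t ht => ?_) ?_
    · have ht0 : (0 : ℝ) < t := zero_lt_one.trans ht
      refine (measure_mono fun x (hx : t < (rho y x)⁻¹) => ?_).trans
        ((surf_rho_le y (ε := t ^ (-(1 / 2) : ℝ)) (by positivity)).trans_eq ?_)
      · have : (t ^ (-(1 / 2) : ℝ)) ^ 2 = t⁻¹ := by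
          rw [← Real.rpow_natCast, ← Real.rpow_mul ht0.le, ← Real.rpow_neg_one]; norm_num
        rw [mem_ofPred_eq, this]
        have hr : 0 < (rho y x)⁻¹ := ht0.trans hx
        exact (le_inv_comm₀ (inv_pos.1 hr) ht0).2 hx.le
      · congr 2
        rw [← Real.rpow_natCast, ← Real.rpow_mul ht0.le]; norm_num
    · exact ((hasFiniteIntegral_iff_ofReal ((ae_restrict_iff' measurableSet_Ioi).2
        (Eventually.of_forall fun t ht => by
          have ht0 : (0 : ℝ) < t := zero_lt_one.trans ht
          simp only [Pi.zero_apply]; positivity))).1 hint.2)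

lemma isOpen_rho_pos (y : S3) : IsOpen {x | 0 < rho y x} :=
  isOpen_lt continuous_const (continuous_rho y)

lemma aestronglyMeasurable_of_continuousAt {E : Type*} [NormedAddCommGroup E] {G : S3 → E} (y : S3)
    (hG : ∀ x, 0 < rho y x → ContinuousAt G x) : AEStronglyMeasurable G surf := by
  have h1 : ContinuousOn G {x | 0 < rho y x} := fun x hx => (hG x hx).continuousWithinAt
  have h2 : AEStronglyMeasurable G (surf.restrict {x | 0 < rho y x}) := by
    exact h1.aestronglyMeasurable (isOpen_rho_pos y).measurableSet
  rwa [Measure.restrict_eq_self_of_ae_mem (s := {x | 0 < rho y x}) (ae_rho_pos y)] at h2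

lemma integrable_of_le {E : Type*} [NormedAddCommGroup E] {G : S3 → E} (y : S3) {C : ℝ}
    (hG : ∀ x, 0 < rho y x → ContinuousAt G x)
    (hC : ∀ x, 0 < rho y x → ‖G x‖ ≤ C / rho y x) : Integrable G surf := by
  refine ((integrable_inv_rho y).const_mul C).mono' (aestronglyMeasurable_of_continuousAt y hG) ?_
  filter_upwards [ae_rho_pos y] with x hx using hC x hx

lemma integrable_of_continuous {E : Type*} [NormedAddCommGroup E] {f : S3 → E}
    (hf : Continuous f) : Integrable f surf :=
  hf.integrable_of_hasCompactSupport (HasCompactSupport.of_compactSpace f)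

lemma exists_bound {E : Type*} [NormedAddCommGroup E] {f : S3 → E}
    (hf : Continuous f) : ∃ M : ℝ, 0 < M ∧ ∀ x, ‖f x‖ ≤ M := by
  obtain ⟨M, hM⟩ := isCompact_univ.exists_bound_of_continuousOn hf.continuousOn
  exact ⟨max M 1, by positivity, fun x => (hM x trivial).trans (le_max_left _ _)⟩

lemma inner_mul_left (x : S3) (a b : ℍ[ℝ]) :
    inner ℝ ((x : ℍ[ℝ]) * a) (x * b) = (inner ℝ a b : ℝ) :=
  LinearIsometry.inner_map_map ⟨LinearMap.mulLeft ℝ (x : ℍ[ℝ]), fun z => by simp⟩ a b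

lemma inner_coe_mul (x : S3) (w : ℍ[ℝ]) : inner ℝ (x : ℍ[ℝ]) (x * w) = w.re := by
  have := inner_mul_left x 1 w
  rw [mul_one] at this
  rw [this]; simp [Quaternion.inner_def]

lemma inner_frame_mul (b : Fin 3) (x : S3) (w : ℍ[ℝ]) :
    inner ℝ (frame b x) (x * w) = (![w.imI, w.imJ, w.imK] b : ℝ) := by
  rw [frame, inner_mul_left]
  fin_cases b <;> simp [Quaternion.inner_def]

lemma frame_expansion (x : S3) (v : ℍ[ℝ]) :
    v = (inner ℝ (x : ℍ[ℝ]) v : ℝ) • (x : ℍ[ℝ]) + ∑ b, (inner ℝ (frame b x) v : ℝ) • frame b x := by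
  obtain ⟨w, rfl⟩ : ∃ w, v = x * w := ⟨(x : ℍ[ℝ])⁻¹ * v, by
    rw [mul_inv_cancel_left₀ (coe_ne_zero x)]⟩
  have h : w = w.re • (1 : ℍ[ℝ]) + ∑ b, (![w.imI, w.imJ, w.imK] b : ℝ) • unit3 b := by
    rw [Fin.sum_univ_three]
    ext <;> simp
  simp only [inner_coe_mul, inner_frame_mul]
  conv_lhs => rw [h]
  simp only [frame, mul_add, Finset.mul_sum, mul_smul_comm, mul_one]

/-- Parseval for y in the orthonormal basis formed by x and the frame at x. -/
lemma sum_inner_frame_sq (y x : S3) : ∑ b, (inner ℝ (frame b x) (y : ℍ[ℝ]) : ℝ) ^ 2 = rho y x := by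
  have h : (y : ℍ[ℝ]) = x * ((x⁻¹ * y : S3) : ℍ[ℝ]) := by
    rw [Metric.unitSphere.coe_mul, Metric.unitSphere.coe_inv, mul_inv_cancel_left₀ (coe_ne_zero x)]
  have hn := normSq_coe (x⁻¹ * y)
  rw [rho, tau, Fin.sum_univ_three, h]
  simp only [inner_coe_mul, inner_frame_mul]
  simp only [Matrix.cons_val]
  linarith

lemma regAt_tau {n : ℕ∞ω} (y x : S3) : RegAt n (tau y) x :=
  regAt_comp_coe (G := fun z => (inner ℝ z (y : ℍ[ℝ]) : ℝ)) (contDiffAt_id.inner ℝ contDiffAt_const)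

lemma regAt_rho {n : ℕ∞ω} (y x : S3) : RegAt n (rho y) x :=
  (regAt_const (1 : ℝ) x).sub (((regAt_tau y x).comp (q := fun t => t ^ 2)
    (contDiff_id.pow 2).contDiffAt))

lemma lder_tau (b : Fin 3) (y x : S3) : lder b (tau y) x = inner ℝ (frame b x) (y : ℍ[ℝ]) := by
  refine (regAt_tau (n := 1) y x).lder_eq one_ne_zero ?_
  have h := (hasDerivAt_mul_flow x b 0).inner ℝ (hasDerivAt_const 0 (y : ℍ[ℝ]))
  simpa [tau] using h

/-- The orbits of the flow are great circles because `unit3 b` squares to -1, so `tau y` is a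
combination of cos t and sin t along them. -/
lemma lder_lder_tau (b : Fin 3) (y x : S3) : lder b (lder b (tau y)) x = - tau y x := by
  have h0 : lder b (tau y) = fun x => inner ℝ (frame b x) (y : ℍ[ℝ]) := funext (lder_tau b y)
  rw [h0]
  refine ((regAt_frame (n := 1) b x).inner (regAt_const (y : ℍ[ℝ]) x)).lder_eq one_ne_zero ?_
  have h := ((hasDerivAt_mul_flow x b 0).mul_const (unit3 b)).inner ℝ
    (hasDerivAt_const 0 (y : ℍ[ℝ]))
  refine h.congr_deriv ?_
  simp [frame, mul_assoc, unit3_mul_self, tau]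

lemma lder_rho (b : Fin 3) (y x : S3) :
    lder b (rho y) x = - (2 * tau y x * lder b (tau y) x) := by
  have h := lder_comp (n := 1) b (x := x) one_ne_zero (q := fun t => 1 - t ^ 2)
    (q' := - (2 * tau y x)) (f := tau y) (by fun_prop)
    (by simpa using ((hasDerivAt_id (tau y x)).pow 2).const_sub 1) (regAt_tau y x)
  change lder b (rho y) x = _ at h
  rw [h]; ring

lemma lder_tau_sq_le (b : Fin 3) (y x : S3) : lder b (tau y) x ^ 2 ≤ rho y x := by
  rw [← sum_inner_frame_sq, lder_tau]
  exact Finset.single_le_sum (f := fun b => (inner ℝ (frame b x) (y : ℍ[ℝ]) : ℝ) ^ 2)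
    (fun i _ => sq_nonneg _) (Finset.mem_univ b)

lemma abs_lder_tau_le (b : Fin 3) (y x : S3) : |lder b (tau y) x| ≤ √(rho y x) :=
  Real.abs_le_sqrt (lder_tau_sq_le b y x)

lemma abs_lder_rho_le (b : Fin 3) (y x : S3) : |lder b (rho y) x| ≤ 2 * √(rho y x) := by
  rw [lder_rho, abs_neg, abs_mul, abs_mul, abs_two]
  have h1 := abs_lder_tau_le b y x
  have h2 := abs_tau_le y x
  nlinarith [abs_nonneg (tau y x), abs_nonneg (lder b (tau y) x)]

/-! ### The divergence theorem with point singularities. -/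

/-- Left-invariant fields are divergence free. -/
lemma integral_lder_eq_zero {u : S3 → ℝ} (hu : ∀ x, RegAt 1 u x) (b : Fin 3) :
    ∫ x, lder b u x ∂surf = 0 := by
  have hc : Continuous (lder b u) :=
    continuous_of_regAt (n := 0) fun x => RegAt.lder (by simpa using hu x) b
  have hcu := continuous_of_regAt hu
  obtain ⟨M, -, hM⟩ := exists_bound hc
  -- By right invariance the integral of u(x * `flow b t`) does not depend on t; its derivative at 0
  -- is the integral in question.
  have h := hasDerivAt_integral_of_dominated_loc_of_deriv_le (μ := surf) (𝕜 := ℝ)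
    (F := fun t x => u (x * flow b t)) (x₀ := 0) (s := univ) (bound := fun _ => M)
    (F' := fun t x => lder b u (x * flow b t)) univ_mem
    (Eventually.of_forall fun t => (hcu.comp (continuous_mul_const _)).aestronglyMeasurable)
    (integrable_of_continuous (hcu.comp (continuous_mul_const _)))
    (hc.comp (continuous_mul_const _)).aestronglyMeasurable
    (Eventually.of_forall fun x t _ => hM _) (integrable_const M)
    (Eventually.of_forall fun x t _ => RegAt.hasDerivAt_flow one_ne_zero (hu _))
  have h2 := h.2
  simp only [integral_mul_right_surf, integral_mul_right_surf u] at h2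
  exact h2.unique (hasDerivAt_const _ _)

/-- A smooth cutoff function, `0` up to `1` and `1` from `2` on. -/
def cutoff (s : ℝ) : ℝ := Real.smoothTransition (s - 1)

lemma contDiff_cutoff {n : ℕ∞} : ContDiff ℝ n cutoff :=
  Real.smoothTransition.contDiff.comp (contDiff_id.sub contDiff_const)

lemma cutoff_of_le {s : ℝ} (h : s ≤ 1) : cutoff s = 0 :=
  Real.smoothTransition.zero_of_nonpos (by linarith)

lemma cutoff_of_ge {s : ℝ} (h : 2 ≤ s) : cutoff s = 1 :=
  Real.smoothTransition.one_of_one_le (by linarith)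

lemma abs_cutoff_le (s : ℝ) : |cutoff s| ≤ 1 := by
  rw [cutoff, abs_of_nonneg (Real.smoothTransition.nonneg _)]; exact Real.smoothTransition.le_one _

lemma deriv_cutoff_of_lt {s : ℝ} (h : s < 1) : deriv cutoff s = 0 := by
  have : cutoff =ᶠ[𝓝 s] fun _ => 0 := by
    filter_upwards [Iio_mem_nhds h] with t ht using cutoff_of_le (le_of_lt ht)
  rw [this.deriv_eq]; simp

lemma deriv_cutoff_of_gt {s : ℝ} (h : 2 < s) : deriv cutoff s = 0 := by
  have : cutoff =ᶠ[𝓝 s] fun _ => 1 := by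
    filter_upwards [Ioi_mem_nhds h] with t ht using cutoff_of_ge (le_of_lt ht)
  rw [this.deriv_eq]; simp

lemma exists_deriv_cutoff_le : ∃ M : ℝ, 0 < M ∧ ∀ s, |deriv cutoff s| ≤ M := by
  obtain ⟨M, hM⟩ := (isCompact_Icc (a := (1 : ℝ)) (b := 2)).exists_bound_of_continuousOn
    ((contDiff_cutoff (n := 1)).continuous_deriv le_rfl).continuousOn
  refine ⟨max M 1, by positivity, fun s => ?_⟩
  by_cases h1 : s < 1
  · rw [deriv_cutoff_of_lt h1]; simp
  by_cases h2 : 2 < s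
  · rw [deriv_cutoff_of_gt h2]; simp
  · exact (hM s ⟨not_lt.1 h1, not_lt.1 h2⟩).trans (le_max_left _ _)

section Div
variable (y : S3) {u : Fin 3 → S3 → ℝ} (hu : ∀ b x, 0 < rho y x → RegAt 1 (u b) x)
include hu

lemma continuousAt_lder_of_regAt (b : Fin 3) {x : S3} (hx : 0 < rho y x) :
    ContinuousAt (lder b (u b)) x :=
  RegAt.continuousAt (n := 0) (RegAt.lder (by simpa using hu b x hx) b)

lemma regAt_cutoff_mul {ε : ℝ} (hε : 0 < ε) (b : Fin 3) (x : S3) :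
    RegAt 1 (fun x => cutoff (rho y x / ε ^ 2) * u b x) x := by
  rcases (rho_nonneg y x).eq_or_lt with h | h
  · refine (regAt_const (0 : ℝ) x).congr_of_eventuallyEq ?_
    have : ∀ᶠ z in 𝓝 x, rho y z < ε ^ 2 :=
      (continuous_rho y).continuousAt.eventually_lt_const (by rw [← h]; positivity)
    filter_upwards [this] with z hz
    rw [cutoff_of_le ((div_le_one (by positivity)).2 hz.le), zero_mul]
  · exact ((regAt_rho y x).comp (q := fun s => cutoff (s / ε ^ 2))
      ((contDiff_cutoff (n := 1)).comp (contDiff_id.div_const _)).contDiffAt).mul (hu b x h)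

lemma lder_cutoff_mul {ε : ℝ} (b : Fin 3) {x : S3} (hx : 0 < rho y x) :
    lder b (fun x => cutoff (rho y x / ε ^ 2) * u b x) x =
      cutoff (rho y x / ε ^ 2) * lder b (u b) x +
        deriv cutoff (rho y x / ε ^ 2) / ε ^ 2 * lder b (rho y) x * u b x := by
  have hq : ContDiffAt ℝ 1 (fun s => cutoff (s / ε ^ 2)) (rho y x) :=
      ((contDiff_cutoff (n := 1)).comp (contDiff_id.div_const _)).contDiffAt
  rw [lder_mul b one_ne_zero ((regAt_rho y x).comp (q := fun s => cutoff (s / ε ^ 2)) hq)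
    (hu b x hx), lder_comp b one_ne_zero hq
    (q' := deriv cutoff (rho y x / ε ^ 2) / ε ^ 2) ?_ (regAt_rho y x)]
  have h1 : HasDerivAt cutoff (deriv cutoff (rho y x / ε ^ 2)) (rho y x / ε ^ 2) :=
    ((contDiff_cutoff (n := 1)).differentiable one_ne_zero _).hasDerivAt
  have := h1.comp (h₂ := cutoff) (h := fun s => s / ε ^ 2) (rho y x)
    ((hasDerivAt_id _).div_const (ε ^ 2))
  simpa [Function.comp_def, div_eq_mul_inv] using this

/-- The cut-off field is of class C¹ everywhere, so its divergence integrates to 0 and only the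
gradient of the cutoff contributes. It lives where ε² ≤ rho ≤ 2ε². There each of the three terms is
at most (M / ε²)(4ε)(δ / ε²), and the measure is at most 64 (2ε)³; the powers of ε cancel and 3 · 4
· 512 = 6144 remains. -/
lemma abs_integral_cutoff_le {M ε δ : ℝ} (hM : ∀ s, |deriv cutoff s| ≤ M) (hε : 0 < ε)
    (hδ0 : 0 ≤ δ) (hδ : ∀ b x, 0 < rho y x → rho y x ≤ (2 * ε) ^ 2 → |u b x| * rho y x ≤ δ) :
    |∫ x, cutoff (rho y x / ε ^ 2) * ∑ b, lder b (u b) x ∂surf| ≤ 6144 * M * δ := by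
  have hM0 : 0 ≤ M := (abs_nonneg _).trans (hM 0)
  set w : Fin 3 → S3 → ℝ := fun b x => cutoff (rho y x / ε ^ 2) * u b x with hw
  have hwr : ∀ b x, RegAt 1 (w b) x := fun b x => regAt_cutoff_mul y hu hε b x
  have hwc : ∀ b, Continuous (lder b (w b)) := fun b =>
    continuous_of_regAt (n := 0) fun x => RegAt.lder (by simpa using hwr b x) b
  have hzero : ∫ x, ∑ b, lder b (w b) x ∂surf = 0 := by
    rw [integral_finsetSum _ fun b _ => integrable_of_continuous (hwc b)]
    exact Finset.sum_eq_zero fun b _ => integral_lder_eq_zero (hwr b) b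
  set R : S3 → ℝ := fun x =>
    ∑ b, deriv cutoff (rho y x / ε ^ 2) / ε ^ 2 * lder b (rho y) x * u b x with hR
  set S : Set S3 := {x | rho y x ≤ (2 * ε) ^ 2} with hS
  have hSm : MeasurableSet S := (isClosed_le (continuous_rho y) continuous_const).measurableSet
  have hRb : ∀ x, 0 < rho y x → ‖R x‖ ≤ S.indicator (fun _ => 12 * M * δ / ε ^ 3) x := by
    intro x hx
    by_cases h1 : rho y x / ε ^ 2 < 1
    · rw [hR]
      simp only [deriv_cutoff_of_lt h1]
      simp only [zero_div, zero_mul, Finset.sum_const_zero, norm_zero]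
      exact indicator_nonneg (fun z hz => by positivity) x
    by_cases h2 : 2 < rho y x / ε ^ 2
    · rw [hR]
      simp only [deriv_cutoff_of_gt h2]
      simp only [zero_div, zero_mul, Finset.sum_const_zero, norm_zero]
      exact indicator_nonneg (fun z hz => by positivity) x
    rw [not_lt, le_div_iff₀ (by positivity), one_mul] at h1
    rw [not_lt, div_le_iff₀ (by positivity)] at h2
    have hxS : rho y x ≤ (2 * ε) ^ 2 := by nlinarith [sq_nonneg ε]
    rw [indicator_of_mem (show x ∈ S from hxS)]
    have hterm : ∀ b : Fin 3,
        ‖deriv cutoff (rho y x / ε ^ 2) / ε ^ 2 * lder b (rho y) x * u b x‖ ≤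
          4 * M * δ / ε ^ 3 := by
      intro b
      have hs : √(rho y x) ≤ 2 * ε := Real.sqrt_le_iff.2 ⟨by positivity, hxS⟩
      have e1 : |lder b (rho y) x| ≤ 4 * ε := (abs_lder_rho_le b y x).trans (by linarith)
      have e2 : |u b x| ≤ δ / ε ^ 2 := by
        rw [le_div_iff₀ (by positivity)]
        exact (mul_le_mul_of_nonneg_left h1 (abs_nonneg _)).trans (hδ b x hx hxS)
      rw [Real.norm_eq_abs, abs_mul, abs_mul, abs_div, abs_of_nonneg (sq_nonneg ε)]
      calc _ ≤ M / ε ^ 2 * (4 * ε) * (δ / ε ^ 2) := by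
            gcongr
            exact hM _
        _ = 4 * M * δ / ε ^ 3 := by field_simp
    refine (norm_sum_le _ _).trans ((Finset.sum_le_sum fun b _ => hterm b).trans_eq ?_)
    simp; ring
  have hae : (fun x => ∑ b, lder b (w b) x) =ᵐ[surf]
      fun x => cutoff (rho y x / ε ^ 2) * ∑ b, lder b (u b) x + R x := by
    filter_upwards [ae_rho_pos y] with x hx
    rw [Finset.mul_sum, hR, ← Finset.sum_add_distrib]
    exact Finset.sum_congr rfl fun b _ => lder_cutoff_mul y hu b hx
  have hRm : AEStronglyMeasurable R surf := by
    refine aestronglyMeasurable_of_continuousAt y fun x hx => ?_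
    refine tendsto_finsetSum _ fun b _ => ?_
    refine ContinuousAt.mul (ContinuousAt.mul ?_ ?_) (hu b x hx).continuousAt
    · refine ContinuousAt.div_const ?_ _
      exact (((contDiff_cutoff (n := 1)).continuous_deriv le_rfl).comp
        ((continuous_rho y).div_const _)).continuousAt
    · exact RegAt.continuousAt (n := 0) (RegAt.lder (regAt_rho y x) b)
  have hIi : Integrable (S.indicator (fun _ => 12 * M * δ / ε ^ 3)) surf :=
    (integrable_const _).indicator hSm
  have hRi : Integrable R surf := hIi.mono' hRm (by
    filter_upwards [ae_rho_pos y] with x hx using hRb x hx)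
  have hsi : Integrable (fun x => ∑ b, lder b (w b) x) surf :=
    integrable_finsetSum _ fun b _ => integrable_of_continuous (hwc b)
  have hXi : Integrable (fun x => cutoff (rho y x / ε ^ 2) * ∑ b, lder b (u b) x) surf := by
    refine (hsi.sub hRi).congr ?_
    filter_upwards [hae] with x hx
    simp only [Pi.sub_apply]
    rw [hx]; ring
  have hsum := integral_congr_ae hae
  rw [integral_add hXi hRi, hzero] at hsum
  have : ∫ x, cutoff (rho y x / ε ^ 2) * ∑ b, lder b (u b) x ∂surf = - ∫ x, R x ∂surf := by
    linarith
  rw [this, abs_neg]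
  refine (norm_integral_le_integral_norm R).trans ?_
  refine (integral_mono_ae hRi.norm hIi (by
    filter_upwards [ae_rho_pos y] with x hx using hRb x hx)).trans ?_
  rw [integral_indicator hSm, setIntegral_const, smul_eq_mul]
  have hSv : surf.real S ≤ 512 * ε ^ 3 := by
    refine ENNReal.toReal_le_of_le_ofReal (by positivity) ?_
    refine (surf_rho_le y (by positivity : 0 ≤ 2 * ε)).trans_eq ?_
    congr 1; ring
  calc _ ≤ 512 * ε ^ 3 * (12 * M * δ / ε ^ 3) := by gcongr
    _ = 6144 * M * δ := by field_simp; ring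

/-- The divergence theorem on the 3-sphere for fields with singularities at `y` and `-y`. -/
theorem integral_div_eq_zero
    (hsmall : ∀ δ > 0, ∃ r > 0, ∀ b x, 0 < rho y x → rho y x ≤ r → |u b x| * rho y x ≤ δ)
    {C : ℝ} (hC : ∀ x, 0 < rho y x → |∑ b, lder b (u b) x| ≤ C / rho y x) :
    ∫ x, ∑ b, lder b (u b) x ∂surf = 0 := by
  obtain ⟨M, hM0, hM⟩ := exists_deriv_cutoff_le
  set D : S3 → ℝ := fun x => ∑ b, lder b (u b) x with hD
  have hDc : ∀ x, 0 < rho y x → ContinuousAt D x := fun x hx =>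
    tendsto_finsetSum _ fun b _ => continuousAt_lder_of_regAt y hu b hx
  set e : ℕ → ℝ := fun n => 1 / ((n : ℝ) + 1) with he
  have he0 : ∀ n, 0 < e n := fun n => by positivity
  have het : Tendsto e atTop (𝓝 0) := tendsto_one_div_add_atTop_nhds_zero_nat
  have hlim : Tendsto (fun n => ∫ x, cutoff (rho y x / e n ^ 2) * D x ∂surf) atTop
      (𝓝 (∫ x, D x ∂surf)) := by
    refine tendsto_integral_of_dominated_convergence (fun x => C * (rho y x)⁻¹) (fun n => ?_)
      ((integrable_inv_rho y).const_mul C) (fun n => ?_) ?_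
    · exact aestronglyMeasurable_of_continuousAt y fun x hx =>
        (((contDiff_cutoff (n := 0)).continuous.comp
          ((continuous_rho y).div_const _)).continuousAt).mul (hDc x hx)
    · filter_upwards [ae_rho_pos y] with x hx
      rw [Real.norm_eq_abs, abs_mul]
      calc _ ≤ 1 * |D x| := by gcongr; exact abs_cutoff_le _
        _ ≤ C * (rho y x)⁻¹ := by rw [one_mul]; exact hC x hx
    · filter_upwards [ae_rho_pos y] with x hx
      refine tendsto_const_nhds.congr' ?_
      have : ∀ᶠ n in atTop, e n ^ 2 < rho y x / 2 := by
        have h := het.pow 2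
        rw [zero_pow two_ne_zero] at h
        exact h.eventually_lt_const (by positivity)
      filter_upwards [this] with n hn
      rw [cutoff_of_ge, one_mul]
      rw [le_div_iff₀ (by have := he0 n; positivity)]
      linarith
  have hbound : ∀ δ > 0, |∫ x, D x ∂surf| ≤ 6144 * M * δ := by
    intro δ hδ
    obtain ⟨r, hr, hsm⟩ := hsmall δ hδ
    refine le_of_tendsto hlim.abs ?_
    have : ∀ᶠ n in atTop, (2 * e n) ^ 2 < r := by
      have h := (het.const_mul 2).pow 2
      rw [mul_zero, zero_pow two_ne_zero] at h
      exact h.eventually_lt_const hr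
    filter_upwards [this] with n hn
    exact abs_integral_cutoff_le y hu hM (he0 n) hδ.le
      fun b x hx hx2 => hsm b x hx (hx2.trans hn.le)
  have h0 : |∫ x, D x ∂surf| ≤ 0 := by
    refine le_of_forall_pos_le_add fun η hη => ?_
    have := hbound (η / (6144 * M)) (by positivity)
    rw [mul_div_cancel₀ _ (by positivity)] at this
    linarith
  exact abs_nonpos_iff.1 h0

end Div

/-! ### Regularity from the derivatives along the frame. -/

lemma fderiv_comp_proj_self (h : S3 → ℝ) (w : ℍ[ℝ]) :
    fderiv ℝ (fun z : ℍ[ℝ] => h (proj z)) w w = 0 := by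
  by_cases hd : DifferentiableAt ℝ (fun z : ℍ[ℝ] => h (proj z)) w
  · have h1 : HasDerivAt (fun t : ℝ => t • w) w 1 := by
      simpa using (hasDerivAt_id (1 : ℝ)).smul_const w
    have h2 := HasFDerivAt.comp_hasDerivAt (f := fun t : ℝ => t • w) 1
      (by simpa using hd.hasFDerivAt) h1
    have h3 : HasDerivAt ((fun z : ℍ[ℝ] => h (proj z)) ∘ fun t : ℝ => t • w) 0 1 := by
      refine (hasDerivAt_const (1 : ℝ) (h (proj w))).congr_of_eventuallyEq ?_
      filter_upwards [Ioi_mem_nhds zero_lt_one] with t ht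
      simp [proj_smul ht]
    exact h2.unique h3
  · rw [fderiv_zero_of_not_differentiableAt hd]; rfl

lemma fderiv_comp_proj (h : S3 → ℝ) {w : ℍ[ℝ]} (hw : w ≠ 0) :
    fderiv ℝ (fun z : ℍ[ℝ] => h (proj z)) w =
      ‖w‖⁻¹ • ∑ b, lder b h (proj w) • innerSL ℝ (frame b (proj w)) := by
  ext v
  conv_lhs => rw [frame_expansion (proj w) v]
  have h1 : ∀ b, frame b (proj w) = ‖w‖⁻¹ • (w * unit3 b) := fun b => by
    rw [frame, coe_proj hw, smul_mul_assoc]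
  have h2 : ∀ b, fderiv ℝ (fun z : ℍ[ℝ] => h (proj z)) w (frame b (proj w)) =
      ‖w‖⁻¹ * lder b h (proj w) := fun b => by
    rw [h1, map_smul, lder_proj b h hw, smul_eq_mul]
  rw [map_add, map_smul, map_sum]
  simp only [map_smul, h2]
  have h3 : fderiv ℝ (fun z : ℍ[ℝ] => h (proj z)) w (proj w : ℍ[ℝ]) = 0 := by
    rw [coe_proj hw, map_smul, fderiv_comp_proj_self h w, smul_zero]
  rw [h3, smul_zero, zero_add]
  simp only [smul_apply, sum_apply, innerSL_apply_apply, smul_eq_mul, Finset.mul_sum]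
  exact Finset.sum_congr rfl fun b _ => by ring

lemma differentiableAt_comp_proj {h : S3 → ℝ}
    (hd : ∀ x : S3, DifferentiableAt ℝ (fun z : ℍ[ℝ] => h (proj z)) x) {w : ℍ[ℝ]} (hw : w ≠ 0) :
    DifferentiableAt ℝ (fun z : ℍ[ℝ] => h (proj z)) w := by
  have h1 := DifferentiableAt.comp w (g := fun z : ℍ[ℝ] => h (proj z))
    (f := fun z => (proj z : ℍ[ℝ])) (hd (proj w))
    ((contDiffAt_coe_proj (n := 1) hw).differentiableAt one_ne_zero)
  simpa only [Function.comp_def, proj_coe] using h1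

lemma regAt_zero {h : S3 → ℝ}
    (hd : ∀ x : S3, DifferentiableAt ℝ (fun z : ℍ[ℝ] => h (proj z)) x) (x : S3) :
    RegAt 0 h x :=
  contDiffAt_zero.2 ⟨{0}ᶜ, isOpen_compl_singleton.mem_nhds (coe_ne_zero x), fun _ hw =>
    (differentiableAt_comp_proj hd hw).continuousAt.continuousWithinAt⟩

/-- The radial derivative of the extension vanishes, so its full derivative is a smooth combination
of the frame derivatives (`fderiv_comp_proj`) and inherits their regularity. -/
lemma regAt_succ {n : ℕ} {h : S3 → ℝ}
    (hd : ∀ x : S3, DifferentiableAt ℝ (fun z : ℍ[ℝ] => h (proj z)) x)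
    (hl : ∀ b x, RegAt n (lder b h) x) (x : S3) : RegAt (n + 1 : ℕ) h x := by
  have hopen : IsOpen ({0}ᶜ : Set ℍ[ℝ]) := isOpen_compl_singleton
  have key : ContDiffOn ℝ ((n : ℕ∞ω) + 1) (fun z : ℍ[ℝ] => h (proj z)) {0}ᶜ := by
    rw [contDiffOn_succ_iff_fderiv_of_isOpen hopen]
    refine ⟨fun w hw => ?_, by simp, fun w hw => ?_⟩
    · exact (differentiableAt_comp_proj hd hw).differentiableWithinAt
    · have : ContDiffAt ℝ n (fun w : ℍ[ℝ] =>
          ‖w‖⁻¹ • ∑ b, lder b h (proj w) • innerSL ℝ (frame b (proj w))) w := by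
        refine ((contDiffAt_norm ℝ hw).inv (norm_ne_zero_iff.2 hw)).smul
          (ContDiffAt.sum fun b _ => ((hl b _).contDiffAt hw).smul ?_)
        exact (innerSL ℝ).contDiff.contDiffAt.comp w ((regAt_frame b _).contDiffAt hw)
      refine (this.congr_of_eventuallyEq ?_).contDiffWithinAt
      filter_upwards [hopen.mem_nhds hw] with z hz using fderiv_comp_proj h hz
  exact key.contDiffAt (hopen.mem_nhds (coe_ne_zero x))

/-! ### Convolution with a singular function of the distance. -/

/-- A function of the distance, continuously differentiable off `0` and `π`, with singularities
of order at most one there. -/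
structure IsC1Kernel (K : ℝ → ℝ) : Prop where
  contDiff : ContDiffOn ℝ 1 K (Ioo 0 Real.pi)
  bound : ∃ C : ℝ, ∀ α ∈ Ioo 0 Real.pi,
    |K α| ≤ C / Real.sin α ∧ |deriv K α| ≤ C / Real.sin α ^ 2

lemma tau_comm (x y : S3) : tau x y = tau y x := real_inner_comm _ _

lemma rho_comm (x y : S3) : rho x y = rho y x := by rw [rho, rho, tau_comm]

lemma ang_comm (x y : S3) : ang x y = ang y x := by rw [ang_eq, ang_eq, tau_comm]

lemma ang_mul_right (x y u : S3) : ang (x * u) (y * u) = ang x y := by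
  rw [ang_eq, ang_eq, tau_mul_right]

lemma sin_ang (x y : S3) : Real.sin (ang x y) = √(rho y x) := Real.sin_arccos _

lemma sin_ang_sq (x y : S3) : Real.sin (ang x y) ^ 2 = rho y x := by
  rw [sin_ang, Real.sq_sqrt (rho_nonneg y x)]

lemma cos_ang (x y : S3) : Real.cos (ang x y) = tau y x :=
  Real.cos_arccos (abs_le.1 (abs_tau_le y x)).1 (abs_le.1 (abs_tau_le y x)).2

lemma ang_mem_Ioo {x y : S3} (h : 0 < rho y x) : ang x y ∈ Ioo 0 Real.pi := by
  have h1 : 0 < Real.sin (ang x y) := by rw [sin_ang]; exact Real.sqrt_pos.2 h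
  have h0 : 0 ≤ ang x y := Real.arccos_nonneg _
  have hp : ang x y ≤ Real.pi := Real.arccos_le_pi _
  refine ⟨h0.lt_of_ne ?_, hp.lt_of_ne ?_⟩
  · intro h; rw [← h] at h1; simp at h1
  · intro h; rw [h] at h1; simp at h1

lemma tau_ne {x y : S3} (h : 0 < rho y x) : tau y x ≠ -1 ∧ tau y x ≠ 1 := by
  constructor <;> (intro h'; rw [rho, h'] at h; norm_num at h)

lemma regAt_ang {n : ℕ∞ω} {x y : S3} (h : 0 < rho y x) : RegAt n (fun x => ang x y) x :=
  (regAt_tau y x).comp (q := Real.arccos) (Real.contDiffAt_arccos (tau_ne h).1 (tau_ne h).2)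

lemma lder_ang (b : Fin 3) {x y : S3} (h : 0 < rho y x) :
    lder b (fun x => ang x y) x = - (lder b (tau y) x / Real.sin (ang x y)) := by
  have := lder_comp b one_ne_zero (q := Real.arccos)
    (Real.contDiffAt_arccos (tau_ne h).1 (tau_ne h).2)
    (Real.hasDerivAt_arccos (tau_ne h).1 (tau_ne h).2) (regAt_tau (n := 1) y x)
  simp only [ang_eq] at this ⊢
  rw [this, Real.sin_arccos]
  ring

lemma regAt_kernel {n : ℕ∞ω} {K : ℝ → ℝ} {x y : S3} (hK : ContDiffAt ℝ n K (ang x y))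
    (h : 0 < rho y x) : RegAt n (fun x => K (ang x y)) x :=
  (regAt_ang h).comp (q := K) hK

lemma lder_kernel (b : Fin 3) {K : ℝ → ℝ} {x y : S3} (hK : ContDiffAt ℝ 1 K (ang x y))
    (h : 0 < rho y x) : lder b (fun x => K (ang x y)) x =
      - (deriv K (ang x y) / Real.sin (ang x y)) * lder b (tau y) x := by
  rw [lder_comp b one_ne_zero (f := fun x => ang x y) hK
    (hK.differentiableAt one_ne_zero).hasDerivAt (regAt_ang h), lder_ang b h]
  ring

/-- The two sides are imaginary components of y⁻¹x and of x⁻¹y, which are conjugate quaternions. -/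
lemma inner_frame_comm (b : Fin 3) (x y : S3) :
    inner ℝ (frame b y) (x : ℍ[ℝ]) = - (inner ℝ (frame b x) (y : ℍ[ℝ]) : ℝ) := by
  simp only [frame, Quaternion.inner_def]
  fin_cases b <;> simp <;> ring

lemma lder_kernel_right (b : Fin 3) {K : ℝ → ℝ} {x y : S3} (hK : ContDiffAt ℝ 1 K (ang x y))
    (h : 0 < rho y x) : lder b (fun z => K (ang x z)) y = - lder b (fun z => K (ang z y)) x := by
  have h' : 0 < rho x y := by rwa [rho_comm]
  have hK' : ContDiffAt ℝ 1 K (ang y x) := by rwa [ang_comm]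
  have h1 := lder_kernel b hK' h'
  simp only [ang_comm _ x] at h1
  rw [h1, lder_kernel b hK h, lder_tau, lder_tau, inner_frame_comm]
  ring

lemma abs_lder_kernel_le (b : Fin 3) {K : ℝ → ℝ} {x y : S3} (hK : ContDiffAt ℝ 1 K (ang x y))
    (h : 0 < rho y x) : |lder b (fun x => K (ang x y)) x| ≤ |deriv K (ang x y)| := by
  rw [lder_kernel b hK h, abs_mul, abs_neg, abs_div, sin_ang, abs_of_nonneg (Real.sqrt_nonneg _)]
  have h0 := Real.sqrt_pos.2 h
  calc _ ≤ |deriv K (ang x y)| / √(rho y x) * √(rho y x) := by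
        gcongr; exact abs_lder_tau_le b y x
    _ = _ := by field_simp

/-- The integral of a function of the distance against a scalar function. -/
def conv (K : ℝ → ℝ) (f : S3 → ℝ) (y : S3) : ℝ := ∫ x, K (ang x y) * f x ∂surf

section Kernel
variable {K : ℝ → ℝ} (hK : IsC1Kernel K)
include hK

lemma IsC1Kernel.contDiffAt {x y : S3} (h : 0 < rho y x) : ContDiffAt ℝ 1 K (ang x y) :=
  hK.contDiff.contDiffAt (isOpen_Ioo.mem_nhds (ang_mem_Ioo h))

/-- The bound with the square root makes boundary terms vanish in the limit; the bounds by 1 / rho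
give integrability. -/
lemma IsC1Kernel.exists_bound : ∃ C : ℝ, 0 < C ∧ ∀ x y : S3, 0 < rho y x →
    |K (ang x y)| ≤ C / √(rho y x) ∧ |K (ang x y)| ≤ C / rho y x ∧
      ∀ b, |lder b (fun x => K (ang x y)) x| ≤ C / rho y x := by
  obtain ⟨C, hC⟩ := hK.bound
  refine ⟨max C 1, by positivity, fun x y h => ?_⟩
  have h0 := Real.sqrt_pos.2 h
  obtain ⟨h1, h2⟩ := hC _ (ang_mem_Ioo h)
  rw [sin_ang] at h1
  rw [sin_ang_sq] at h2
  have h1' : |K (ang x y)| ≤ max C 1 / √(rho y x) :=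
    h1.trans (by gcongr; exact le_max_left _ _)
  refine ⟨h1', h1'.trans ?_, fun b => (abs_lder_kernel_le b (hK.contDiffAt h) h).trans
    (h2.trans (by gcongr; exact le_max_left _ _))⟩
  gcongr
  exact Real.le_sqrt_of_sq_le (by nlinarith [rho_le_one y x])

lemma IsC1Kernel.integrable_mul {E : Type*} [NormedAddCommGroup E] [NormedSpace ℝ E]
    {f : S3 → E} (hf : Continuous f) (y : S3) :
    Integrable (fun x => K (ang x y) • f x) surf := by
  obtain ⟨C, hC0, hC⟩ := hK.exists_bound
  obtain ⟨M, hM0, hM⟩ := SphereConv.exists_bound hf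
  refine integrable_of_le y (C := C * M) (fun x hx => ?_) fun x hx => ?_
  · exact (regAt_kernel (hK.contDiffAt hx) hx).continuousAt.smul hf.continuousAt
  · rw [norm_smul, Real.norm_eq_abs, mul_div_right_comm]
    have := rho_nonneg y x
    exact mul_le_mul (hC x y hx).2.1 (hM x) (norm_nonneg _) (by positivity)

lemma IsC1Kernel.integrable_lder_mul {f : S3 → ℝ} (hf : Continuous f) (b : Fin 3) (y : S3) :
    Integrable (fun x => lder b (fun x => K (ang x y)) x * f x) surf := by
  obtain ⟨C, hC0, hC⟩ := hK.exists_bound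
  obtain ⟨M, hM0, hM⟩ := SphereConv.exists_bound hf
  refine integrable_of_le y (C := C * M) (fun x hx => ?_) fun x hx => ?_
  · exact (RegAt.continuousAt (n := 0)
      (RegAt.lder (by simpa using regAt_kernel (hK.contDiffAt hx) hx) b)).mul hf.continuousAt
  · rw [norm_mul, Real.norm_eq_abs, mul_div_right_comm]
    have := rho_nonneg y x
    exact mul_le_mul ((hC x y hx).2.2 b) (hM x) (norm_nonneg _) (by positivity)

lemma IsC1Kernel.integral_lder_mul {f : S3 → ℝ} (hf : Smooth f) (b : Fin 3) (y : S3) :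
    ∫ x, lder b (fun x => K (ang x y)) x * f x ∂surf = - conv K (lder b f) y := by
  rw [smooth_iff] at hf
  have hfc := continuous_of_regAt hf
  have hfb : Continuous (lder b f) := continuous_of_regAt fun x => (hf x).lder_infty b
  obtain ⟨C, hC0, hC⟩ := hK.exists_bound
  obtain ⟨M, hM0, hM⟩ := SphereConv.exists_bound hfc
  obtain ⟨N, hN0, hN⟩ := SphereConv.exists_bound hfb
  have hf1 : ∀ x, RegAt 1 f x := fun x => (hf x).of_le (by norm_cast)
  -- The field K f E_b; its divergence is the product rule that is to be integrated.
  set u : Fin 3 → S3 → ℝ := fun c x => if c = b then K (ang x y) * f x else 0 with hu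
  have hub : u b = fun x => K (ang x y) * f x := by funext x; simp [hu]
  have hul : ∀ x, 0 < rho y x → ∑ c, lder c (u c) x =
      K (ang x y) * lder b f x + lder b (fun x => K (ang x y)) x * f x := by
    intro x hx
    rw [Finset.sum_eq_single b, hub,
      lder_mul b one_ne_zero (regAt_kernel (hK.contDiffAt hx) hx) (hf1 x)]
    · intro c _ hc
      have : u c = fun _ => 0 := by funext x; simp [hu, hc]
      rw [this, lder_const]
    · simp
  have hur : ∀ c x, 0 < rho y x → RegAt 1 (u c) x := by
    intro c x hx
    by_cases hc : c = b
    · rw [hc, hub]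
      exact (regAt_kernel (hK.contDiffAt hx) hx).mul (hf1 x)
    · have : u c = fun _ => 0 := by funext x; simp [hu, hc]
      rw [this]
      exact regAt_const 0 x
  have hdiv := integral_div_eq_zero y hur (C := C * N + C * M) (fun δ hδ => ?_) fun x hx => ?_
  · have hae : (fun x => ∑ c, lder c (u c) x) =ᵐ[surf]
        fun x => K (ang x y) * lder b f x + lder b (fun x => K (ang x y)) x * f x := by
      filter_upwards [ae_rho_pos y] with x hx using hul x hx
    have hi : Integrable (fun x => K (ang x y) * lder b f x) surf := hK.integrable_mul hfb y
    rw [integral_congr_ae hae, integral_add hi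
      (hK.integrable_lder_mul hfc b y)] at hdiv
    rw [conv]
    linarith
  -- |K f| rho is at most C M √rho.
  · refine ⟨(δ / (C * M)) ^ 2, by positivity, fun c x hx hxr => ?_⟩
    by_cases hc : c = b
    · rw [hc, hub]
      have hs : √(rho y x) ≤ δ / (C * M) := Real.sqrt_le_iff.2 ⟨by positivity, hxr⟩
      have h0 := Real.sqrt_pos.2 hx
      rw [abs_mul]
      calc _ ≤ C / √(rho y x) * M * (√(rho y x) * √(rho y x)) := by
            rw [Real.mul_self_sqrt hx.le]
            gcongr
            exacts [(hC x y hx).1, hM x]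
        _ = C * M * √(rho y x) := by field_simp
        _ ≤ C * M * (δ / (C * M)) := by gcongr
        _ = δ := by field_simp
    · simp [hu, hc, hδ.le]
  · rw [hul x hx, add_div]
    refine (abs_add_le _ _).trans (add_le_add ?_ ?_)
    · rw [abs_mul, mul_div_right_comm]
      gcongr
      exacts [(hC x y hx).2.1, hN x]
    · rw [abs_mul, mul_div_right_comm]
      gcongr
      exacts [(hC x y hx).2.2 b, hM x]

lemma IsC1Kernel.lder_right_ae (b : Fin 3) (y : S3) :
    (fun x => lder b (fun z => K (ang x z)) y) =ᵐ[surf]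
      fun x => - lder b (fun z => K (ang z y)) x := by
  filter_upwards [ae_rho_pos y] with x hx using lder_kernel_right b (hK.contDiffAt hx) hx

lemma IsC1Kernel.integrable_mul_lder_right {f : S3 → ℝ} (hf : Continuous f) (b : Fin 3) (y : S3) :
    Integrable (fun x => f x * lder b (fun z => K (ang x z)) y) surf := by
  refine (hK.integrable_lder_mul hf b y).neg.congr ?_
  filter_upwards [hK.lder_right_ae b y] with x hx
  rw [hx, Pi.neg_apply]; ring

/-- Differentiation under the integral of a singular kernel. -/
lemma IsC1Kernel.integral_mul_lder_right {f : S3 → ℝ} (hf : Smooth f) (b : Fin 3) (y : S3) :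
    ∫ x, f x * lder b (fun z => K (ang x z)) y ∂surf = conv K (lder b f) y := by
  have h : (fun x => f x * lder b (fun z => K (ang x z)) y) =ᵐ[surf]
      fun x => - (lder b (fun x => K (ang x y)) x * f x) := by
    filter_upwards [hK.lder_right_ae b y] with x hx
    rw [hx]; ring
  rw [integral_congr_ae h, integral_neg, hK.integral_lder_mul hf, neg_neg]

-- Right translation by y makes the singular factor independent of y, so derivatives in y fall on f
-- alone.
omit hK in
lemma conv_eq (f : S3 → ℝ) (y : S3) : conv K f y = ∫ x, K (ang x 1) * f (x * y) ∂surf := by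
  rw [conv, ← integral_mul_right_surf _ y]
  have : ∀ x : S3, ang (x * y) y = ang x 1 := fun x => by
    simpa using ang_mul_right x 1 y
  simp only [this]

lemma IsC1Kernel.hasFDerivAt_conv {f : S3 → ℝ} (hf : Smooth f) (y : S3) :
    Integrable (fun x : S3 => K (ang x 1) • (fderiv ℝ (fun z : ℍ[ℝ] => f (proj z))
      ((x : ℍ[ℝ]) * y)).comp (ContinuousLinearMap.mul ℝ ℍ[ℝ] x)) surf ∧
    HasFDerivAt (fun z : ℍ[ℝ] => conv K f (proj z))
      (∫ x, K (ang x 1) • (fderiv ℝ (fun z : ℍ[ℝ] => f (proj z)) ((x : ℍ[ℝ]) * y)).comp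
        (ContinuousLinearMap.mul ℝ ℍ[ℝ] x) ∂surf) (y : ℍ[ℝ]) := by
  have hfr := smooth_iff.1 hf
  set F : ℍ[ℝ] → ℝ := fun z => f (proj z) with hF
  have hFc : ∀ z : ℍ[ℝ], z ≠ 0 → ContDiffAt ℝ ∞ F z := fun z hz => (hfr _).contDiffAt hz
  have hdF : ∀ z : ℍ[ℝ], z ≠ 0 → HasFDerivAt F (fderiv ℝ F z) z := fun z hz =>
    ((hFc z hz).differentiableAt (by simp)).hasFDerivAt
  have hcF : ∀ z : ℍ[ℝ], z ≠ 0 → ContinuousAt (fderiv ℝ F) z := fun z hz =>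
    ((hFc z hz).fderiv_right (m := 0) (by norm_cast)).continuousAt
  have hann : IsCompact (Metric.closedBall (0 : ℍ[ℝ]) 2 \ Metric.ball 0 (1 / 2)) :=
    (isCompact_closedBall _ _).diff Metric.isOpen_ball
  -- ‖x * w‖ = ‖w‖, so for w within 1/2 of y the argument of the derivative stays in this compact
  -- annulus, away from the singular point 0 of `proj`.
  obtain ⟨M, hM⟩ := hann.exists_bound_of_continuousOn (f := fderiv ℝ F) fun z hz => by
    refine (hcF z ?_).continuousWithinAt
    rintro rfl
    exact hz.2 (by simp)
  have hκ := hK.integrable_mul (f := fun _ => (1 : ℝ)) continuous_const 1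
  simp only [smul_eq_mul, mul_one] at hκ
  have hball : ∀ w ∈ Metric.ball (y : ℍ[ℝ]) (1 / 2), 1 / 2 < ‖w‖ ∧ ‖w‖ < 2 := by
    intro w hw
    rw [mem_ball_iff_norm] at hw
    have h1 := norm_sub_norm_le w (y : ℍ[ℝ])
    have h2 := norm_sub_norm_le (y : ℍ[ℝ]) w
    rw [norm_sub_rev] at h2
    rw [norm_coe] at h1 h2
    constructor <;> linarith
  have hne : ∀ w ∈ Metric.ball (y : ℍ[ℝ]) (1 / 2), w ≠ 0 := fun w hw h => by
    have := (hball w hw).1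
    rw [h, norm_zero] at this
    norm_num at this
  have hmeas : AEStronglyMeasurable (fun x : S3 => K (ang x 1) • (fderiv ℝ F (x * y)).comp
      (ContinuousLinearMap.mul ℝ ℍ[ℝ] x)) surf := by
    refine hκ.aestronglyMeasurable.smul (Continuous.aestronglyMeasurable ?_)
    have h1 : Continuous fun x : S3 => fderiv ℝ F ((x : ℍ[ℝ]) * y) :=
      continuous_iff_continuousAt.2 fun x => ContinuousAt.comp
        (f := fun x : S3 => (x : ℍ[ℝ]) * y) (hcF _ (mul_ne_zero (coe_ne_zero x) (coe_ne_zero y)))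
        (by fun_prop)
    exact h1.clm_comp ((ContinuousLinearMap.mul ℝ ℍ[ℝ]).continuous.comp continuous_subtype_val)
  have hbd : ∀ x : S3, ∀ w ∈ Metric.ball (y : ℍ[ℝ]) (1 / 2),
      ‖K (ang x 1) • (fderiv ℝ F (x * w)).comp (ContinuousLinearMap.mul ℝ ℍ[ℝ] x)‖ ≤
        |K (ang x 1)| * M := by
    intro x w hw
    rw [norm_smul, Real.norm_eq_abs]
    gcongr
    refine (ContinuousLinearMap.opNorm_comp_le _ _).trans ?_
    have h1 : ‖ContinuousLinearMap.mul ℝ ℍ[ℝ] (x : ℍ[ℝ])‖ ≤ 1 := by simp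
    have h2 : ‖fderiv ℝ F (x * w)‖ ≤ M := by
      refine hM _ ⟨?_, ?_⟩
      · rw [mem_closedBall_zero_iff, norm_mul, norm_coe, one_mul]
        exact (hball w hw).2.le
      · rw [mem_ball_zero_iff, norm_mul, norm_coe, one_mul, not_lt]
        exact (hball w hw).1.le
    have hM0 : 0 ≤ M := (norm_nonneg (fderiv ℝ F (x * w))).trans h2
    exact (mul_le_mul h2 h1 (norm_nonneg _) hM0).trans_eq (mul_one M)
  refine ⟨(hκ.abs.mul_const M).mono' hmeas (Eventually.of_forall fun x =>
    hbd x y (Metric.mem_ball_self (by norm_num))), ?_⟩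
  have hmain := hasFDerivAt_integral_of_dominated_of_fderiv_le (μ := surf) (𝕜 := ℝ)
    (F := fun (w : ℍ[ℝ]) (x : S3) => K (ang x 1) * F (x * w)) (x₀ := (y : ℍ[ℝ]))
    (F' := fun (w : ℍ[ℝ]) (x : S3) => K (ang x 1) • (fderiv ℝ F (x * w)).comp
        (ContinuousLinearMap.mul ℝ ℍ[ℝ] x)) (bound := fun x => |K (ang x 1)| * M)
    (s := Metric.ball (y : ℍ[ℝ]) (1 / 2)) (Metric.ball_mem_nhds _ (by norm_num))
    ?_ ?_ hmeas (Eventually.of_forall hbd) (hκ.abs.mul_const M) ?_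
  · refine hmain.congr_of_eventuallyEq ?_
    filter_upwards [isOpen_ne.mem_nhds (coe_ne_zero y)] with w hw
    rw [conv_eq]
    simp only [hF, proj_coe_mul _ hw]
  · filter_upwards [isOpen_ne.mem_nhds (coe_ne_zero y)] with w hw
    refine hκ.aestronglyMeasurable.mul (Continuous.aestronglyMeasurable ?_)
    simp only [hF, proj_coe_mul _ hw]
    exact (continuous_of_regAt hfr).comp (continuous_mul_const _)
  · have : ∀ x : S3, F ((x : ℍ[ℝ]) * y) = f (x * y) := fun x => by
      simp only [hF, proj_coe_mul _ (coe_ne_zero y), proj_coe]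
    simp only [this]
    exact hK.integrable_mul ((continuous_of_regAt hfr).comp (continuous_mul_const y)) 1
  · refine Eventually.of_forall fun x w hw => ?_
    have h1 := (hdF _ (mul_ne_zero (coe_ne_zero x) (hne w hw))).comp w
      (ContinuousLinearMap.mul ℝ ℍ[ℝ] (x : ℍ[ℝ])).hasFDerivAt
    exact h1.const_mul (K (ang x 1))

lemma IsC1Kernel.lder_conv {f : S3 → ℝ} (hf : Smooth f) (b : Fin 3) :
    lder b (conv K f) = conv K (lder b f) := by
  funext y
  rw [lder, tderiv, (hK.hasFDerivAt_conv hf y).2.fderiv, conv_eq,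
    ContinuousLinearMap.integral_apply (hK.hasFDerivAt_conv hf y).1]
  refine integral_congr_ae (Eventually.of_forall fun x => ?_)
  simp [lder, tderiv, frame, mul_assoc]

/-- Induction on the order for all f at once, since each derivative of the convolution is the
convolution with a derivative of f. -/
lemma IsC1Kernel.smooth_conv {f : S3 → ℝ} (hf : Smooth f) : Smooth (conv K f) := by
  have key : ∀ n : ℕ, ∀ f : S3 → ℝ, Smooth f → ∀ x, RegAt n (conv K f) x := by
    intro n
    induction n with
    | zero =>
      intro f hf x
      exact regAt_zero (fun x => (hK.hasFDerivAt_conv hf x).2.differentiableAt) x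
    | succ n ih =>
      intro f hf x
      refine regAt_succ (fun x => (hK.hasFDerivAt_conv hf x).2.differentiableAt) (fun b x => ?_) x
      rw [hK.lder_conv hf]
      exact ih _ (smooth_iff.2 fun x => (smooth_iff.1 hf x).lder_infty b) x
  exact smooth_iff.2 fun x => contDiffAt_infty.2 fun n => key n f hf x

end Kernel

/-! ### The distributional Laplacian of a kernel and its mass on the diagonal. -/

/-- The sum of the second derivatives along the left-invariant frame. -/
def slap (f : S3 → ℝ) (x : S3) : ℝ := ∑ b, lder b (lder b f) x

lemma sin_pos_of_mem {α : ℝ} (h : α ∈ Ioo 0 Real.pi) : 0 < Real.sin α :=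
  Real.sin_pos_of_mem_Ioo h

section KernelFun
variable {φ : ℝ → ℝ} (hφ : IsKernelFun φ)
include hφ

lemma IsKernelFun.exists_bound : ∃ C : ℝ, 0 < C ∧ ∀ α ∈ Ioo 0 Real.pi,
    |φ α| ≤ C / α ∧ |deriv φ α| ≤ C / α ^ 2 := by
  obtain ⟨C, hC⟩ := hφ.bound
  refine ⟨max C 1, by positivity, fun α hα => ?_⟩
  have h0 := hα.1
  exact ⟨(hC α hα).1.trans (by gcongr; exact le_max_left _ _),
    (hC α hα).2.trans (by gcongr; exact le_max_left _ _)⟩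

lemma IsKernelFun.isC1Kernel : IsC1Kernel φ where
  contDiff := hφ.contDiff.of_le (by norm_num)
  bound := by
    obtain ⟨C, hC0, hC⟩ := hφ.exists_bound
    refine ⟨C, fun α hα => ?_⟩
    have h1 := sin_pos_of_mem hα
    have h2 := Real.sin_le hα.1.le
    exact ⟨(hC α hα).1.trans (by gcongr), (hC α hα).2.trans (by gcongr)⟩

lemma IsKernelFun.contDiffAt {α : ℝ} (hα : α ∈ Ioo 0 Real.pi) : ContDiffAt ℝ 3 φ α :=
  hφ.contDiff.contDiffAt (isOpen_Ioo.mem_nhds hα)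

lemma IsKernelFun.contDiffAt_deriv {α : ℝ} (hα : α ∈ Ioo 0 Real.pi) :
    ContDiffAt ℝ 2 (deriv φ) α := by
  have := (hφ.contDiffAt hα).fderiv_right (m := 2) (by norm_num)
  exact this.clm_apply contDiffAt_const

lemma IsKernelFun.isC1Kernel_radLap : IsC1Kernel (radLap φ) where
  contDiff := fun α hα => by
    have h1 : ContDiffAt ℝ 2 (fun t => Real.sin t ^ 2 * deriv φ t) α :=
      (Real.contDiff_sin.contDiffAt.pow 2).mul (hφ.contDiffAt_deriv hα)
    have h2 : ContDiffAt ℝ 1 (deriv fun t => Real.sin t ^ 2 * deriv φ t) α :=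
      (h1.fderiv_right (m := 1) (by norm_num)).clm_apply contDiffAt_const
    have h3 : ContDiffAt ℝ 1 (fun t => 1 / Real.sin t ^ 2) α :=
      contDiffAt_const.div (Real.contDiff_sin.contDiffAt.pow 2)
        (pow_ne_zero 2 (sin_pos_of_mem hα).ne')
    exact (h3.mul h2).contDiffWithinAt
  bound := hφ.bound_lap

lemma IsKernelFun.radLap_eq {α : ℝ} (hα : α ∈ Ioo 0 Real.pi) :
    radLap φ α = deriv (deriv φ) α + 2 * (Real.cos α / Real.sin α) * deriv φ α := by
  have hs := (sin_pos_of_mem hα).ne'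
  have h1 : HasDerivAt (deriv φ) (deriv (deriv φ) α) α :=
    ((hφ.contDiffAt_deriv hα).differentiableAt two_ne_zero).hasDerivAt
  have h2 := ((Real.hasDerivAt_sin α).pow 2).mul h1
  have h3 : deriv (fun t => Real.sin t ^ 2 * deriv φ t) α = _ := h2.deriv
  rw [radLap, h3]
  field_simp
  simp only [Pi.pow_apply]
  push_cast
  ring

/-- The first derivatives are q E_b τ with q = -φ' / sin. Differentiating again, E_b² τ = -τ and Σ
(E_b τ)² = sin² turn the sum into φ'' + 2 cot φ'. -/
lemma IsKernelFun.slap_kernel {x y : S3} (h : 0 < rho y x) :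
    slap (fun x => φ (ang x y)) x = radLap φ (ang x y) := by
  have hα := ang_mem_Ioo h
  have hs := (sin_pos_of_mem hα).ne'
  set q : ℝ → ℝ := fun α => - (deriv φ α / Real.sin α) with hq
  have hqc : ContDiffAt ℝ 1 q (ang x y) :=
    (((hφ.contDiffAt_deriv hα).of_le (by norm_num)).div Real.contDiff_sin.contDiffAt hs).neg
  have hqd : HasDerivAt q (- ((deriv (deriv φ) (ang x y) * Real.sin (ang x y) -
      deriv φ (ang x y) * Real.cos (ang x y)) / Real.sin (ang x y) ^ 2)) (ang x y) :=
    ((((hφ.contDiffAt_deriv hα).differentiableAt two_ne_zero).hasDerivAt).div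
      (Real.hasDerivAt_sin _) hs).neg
  have key : ∀ b, lder b (lder b fun x => φ (ang x y)) x =
      - (q (ang x y) * tau y x) -
        deriv q (ang x y) / Real.sin (ang x y) * lder b (tau y) x ^ 2 := by
    intro b
    have he : lder b (fun x => φ (ang x y)) =ᶠ[𝓝 x] fun x => q (ang x y) * lder b (tau y) x := by
      filter_upwards [(isOpen_rho_pos y).mem_nhds h] with z hz
      rw [lder_kernel b ((hφ.contDiffAt (ang_mem_Ioo hz)).of_le (by norm_num)) hz]
    rw [lder_congr he, lder_mul b one_ne_zero (regAt_kernel hqc h)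
      (RegAt.lder (n := 1) (regAt_tau y x) b), lder_lder_tau, lder_kernel b hqc h]
    ring
  have hsum : ∑ b, lder b (tau y) x ^ 2 = Real.sin (ang x y) ^ 2 := by
    rw [sin_ang_sq, ← sum_inner_frame_sq]
    simp only [lder_tau]
  rw [slap]
  simp only [key]
  rw [Finset.sum_sub_distrib, ← Finset.mul_sum, hsum, hφ.radLap_eq hα, hqd.deriv]
  simp only [Finset.sum_const, Finset.card_univ, Fintype.card_fin, nsmul_eq_mul, hq, ← cos_ang x y]
  field_simp
  push_cast
  ring

/-- Green's formula: the divergence theorem for f ∇φ, where `hsmall` removes the flux at ±y,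
followed by `integral_lder_mul` for the terms E_b φ · E_b f, where φ is too weakly singular to leave
a flux. -/
lemma IsKernelFun.conv_radLap {f : S3 → ℝ} (hf : Smooth f) (y : S3)
    (hsmall : ∀ δ > 0, ∃ r > 0, ∀ x, 0 < rho y x → rho y x ≤ r →
      |deriv φ (ang x y)| * |f x| * rho y x ≤ δ) :
    conv (radLap φ) f y = conv φ (slap f) y := by
  have hK := hφ.isC1Kernel
  have hL := hφ.isC1Kernel_radLap
  have hfr := smooth_iff.1 hf
  have hfc := continuous_of_regAt hfr
  have hf1 : ∀ x, RegAt 1 f x := fun x => (hfr x).of_le (by norm_cast)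
  have hfb : ∀ b, Smooth (lder b f) := fun b => smooth_iff.2 fun x => (hfr x).lder_infty b
  have hfbc : ∀ b, Continuous (lder b f) := fun b => continuous_of_regAt (smooth_iff.1 (hfb b))
  have hfbbc : ∀ b, Continuous (lder b (lder b f)) := fun b =>
    continuous_of_regAt fun x => (smooth_iff.1 (hfb b) x).lder_infty b
  have hker : ∀ x, 0 < rho y x → RegAt 3 (fun x => φ (ang x y)) x := fun x hx =>
    regAt_kernel (hφ.contDiffAt (ang_mem_Ioo hx)) hx
  have hker1 : ∀ b x, 0 < rho y x → RegAt 1 (lder b fun x => φ (ang x y)) x := fun b x hx =>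
    RegAt.lder ((hker x hx).of_le (by norm_num)) b
  have hsum : ∀ x, 0 < rho y x →
      ∑ b, lder b (fun x => lder b (fun x => φ (ang x y)) x * f x) x =
        radLap φ (ang x y) * f x + ∑ b, lder b (fun x => φ (ang x y)) x * lder b f x := by
    intro x hx
    rw [← hφ.slap_kernel hx, slap, Finset.sum_mul, ← Finset.sum_add_distrib]
    refine Finset.sum_congr rfl fun b _ => ?_
    rw [lder_mul b one_ne_zero (hker1 b x hx) (hf1 x)]
    ring
  obtain ⟨C, hC0, hC⟩ := hK.exists_bound
  obtain ⟨C', hC0', hC'⟩ := hL.exists_bound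
  obtain ⟨M, hM0, hM⟩ := SphereConv.exists_bound hfc
  choose N hN0 hN using fun b => SphereConv.exists_bound (hfbc b)
  have hdiv := integral_div_eq_zero y
    (u := fun b x => lder b (fun x => φ (ang x y)) x * f x)
    (fun b x hx => (hker1 b x hx).mul (hf1 x)) (C := C' * M + ∑ b, C * N b)
    (fun δ hδ => ?_) (fun x hx => ?_)
  · have hae : (fun x => ∑ b, lder b (fun x => lder b (fun x => φ (ang x y)) x * f x) x) =ᵐ[surf]
        fun x => radLap φ (ang x y) * f x + ∑ b, lder b (fun x => φ (ang x y)) x * lder b f x := by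
      filter_upwards [ae_rho_pos y] with x hx using hsum x hx
    have hi : Integrable (fun x => radLap φ (ang x y) * f x) surf := hL.integrable_mul hfc y
    have hi2 : ∀ b, Integrable (fun x => φ (ang x y) * lder b (lder b f) x) surf :=
      fun b => hK.integrable_mul (hfbbc b) y
    rw [integral_congr_ae hae, integral_add hi
      (integrable_finsetSum _ fun b _ => hK.integrable_lder_mul (hfbc b) b y),
      integral_finsetSum _ fun b _ => hK.integrable_lder_mul (hfbc b) b y] at hdiv
    simp only [hK.integral_lder_mul (hfb _)] at hdiv
    have h2 : conv φ (slap f) y = ∑ b, conv φ (lder b (lder b f)) y := by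
      simp only [conv, slap, Finset.mul_sum]
      rw [integral_finsetSum _ fun b _ => hi2 b]
    rw [h2, conv]
    simp only [Finset.sum_neg_distrib] at hdiv
    linarith
  · obtain ⟨r, hr, h⟩ := hsmall δ hδ
    refine ⟨r, hr, fun b x hx hxr => le_trans ?_ (h x hx hxr)⟩
    rw [abs_mul]
    exact mul_le_mul_of_nonneg_right (mul_le_mul_of_nonneg_right
      (abs_lder_kernel_le b (hK.contDiffAt hx) hx) (abs_nonneg _)) hx.le
  · rw [hsum x hx, add_div, Finset.sum_div]
    refine (abs_add_le _ _).trans (add_le_add ?_ ((Finset.abs_sum_le_sum_abs _ _).trans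
      (Finset.sum_le_sum fun b _ => ?_)))
    · rw [abs_mul, mul_div_right_comm]
      exact mul_le_mul (hC' x y hx).2.1 (hM x) (abs_nonneg _) (by positivity)
    · rw [abs_mul, mul_div_right_comm]
      exact mul_le_mul ((hC x y hx).2.2 b) (hN b x) (abs_nonneg _) (by positivity)

-- Jordan's inequality sin α ≥ (2 / π) α on [0, π / 2], with 2 / π ≥ 1 / 2.
omit hφ in
lemma ang_lt_of_tau_pos {x y : S3} (h : 0 < tau y x) : ang x y ≤ 2 * √(rho y x) := by
  have h1 : ang x y ≤ Real.pi / 2 := Real.arccos_le_pi_div_two.2 h.le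
  have h2 := Real.mul_le_sin (Real.arccos_nonneg (tau y x)) h1
  change 2 / Real.pi * ang x y ≤ Real.sin (ang x y) at h2
  have h0 : 0 ≤ ang x y := Real.arccos_nonneg _
  rw [sin_ang] at h2
  have h3 : (1 / 2 : ℝ) ≤ 2 / Real.pi := by
    rw [div_le_div_iff₀ two_pos Real.pi_pos]; linarith [Real.pi_le_four]
  nlinarith

/-- The derivative of the kernel times `sin ^ 2` is small near the antipode. -/
lemma IsKernelFun.small_of_small_near {f : S3 → ℝ} (hf : Continuous f) (y : S3)
    (hnear : ∀ δ > 0, ∃ r > 0, ∀ x, 0 < rho y x → rho y x ≤ r → 0 < tau y x →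
      |deriv φ (ang x y)| * |f x| * rho y x ≤ δ) :
    ∀ δ > 0, ∃ r > 0, ∀ x, 0 < rho y x → rho y x ≤ r →
      |deriv φ (ang x y)| * |f x| * rho y x ≤ δ := by
  intro δ hδ
  obtain ⟨C, hC0, hC⟩ := hφ.exists_bound
  obtain ⟨M, hM0, hM⟩ := SphereConv.exists_bound hf
  obtain ⟨r, hr, h⟩ := hnear δ hδ
  refine ⟨min r (δ / (C * M)), by positivity, fun x hx hxr => ?_⟩
  by_cases ht : 0 < tau y x
  · exact h x hx (hxr.trans (min_le_left _ _)) ht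
  · have h1 : Real.pi / 2 ≤ ang x y := by
      rw [ang_eq, Real.arccos]
      have := Real.arcsin_nonpos.2 (not_lt.1 ht)
      linarith
    -- The singularity of φ is allowed only at α = 0: away from it C / α² bounds φ' by C, and the
    -- factor rho gives smallness.
    have h2 : 1 ≤ ang x y := by linarith [Real.pi_gt_three]
    have h3 : |deriv φ (ang x y)| ≤ C :=
      (hC _ (ang_mem_Ioo hx)).2.trans (div_le_self hC0.le (one_le_pow₀ h2))
    calc _ ≤ C * M * (δ / (C * M)) := by
          gcongr
          exacts [hM x, hxr.trans (min_le_right _ _)]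
      _ = δ := by field_simp

omit hφ in
lemma deriv_mul_rho_le {C : ℝ} (hC : ∀ α ∈ Ioo 0 Real.pi, |deriv φ α| ≤ C / α ^ 2)
    {x y : S3} (hx : 0 < rho y x) : |deriv φ (ang x y)| * rho y x ≤ C := by
  have hα := ang_mem_Ioo hx
  have h1 := hC _ hα
  have h0 := hα.1
  have h2 := Real.sin_le hα.1.le
  have h3 := (sin_pos_of_mem hα).le
  rw [le_div_iff₀ (by positivity)] at h1
  rw [← sin_ang_sq]
  refine le_trans ?_ h1
  gcongr

/-- The mass at the diagonal of the Laplacian of a kernel function. -/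
def lapMass (φ : ℝ → ℝ) : ℝ := - conv (radLap φ) (fun _ => 1) 1

omit hφ in
lemma conv_radLap_one (y : S3) : conv (radLap φ) (fun _ => 1) y = - lapMass φ := by
  rw [lapMass, neg_neg, conv_eq, conv_eq]

omit hφ in
lemma slap_const (c : ℝ) : slap (fun _ => c) = fun _ => 0 := by
  funext x
  have h : ∀ b, lder b (fun _ : S3 => c) = fun _ => 0 := fun b => funext fun x => lder_const b c
  simp only [slap, h, lder_const, Finset.sum_const_zero]

/-- Under this decay Green's formula admits the test function 1, for which it reads ∫ ψ = 0. -/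
lemma IsKernelFun.lapMass_eq_zero
    (h : Tendsto (fun α : ℝ => α ^ 2 * deriv φ α) (𝓝[>] 0) (𝓝 0)) : lapMass φ = 0 := by
  have h1 := hφ.conv_radLap (f := fun _ => 1) (smooth_iff.2 fun x => regAt_const 1 x) 1
    (hφ.small_of_small_near continuous_const 1 fun δ hδ => ?_)
  · rw [slap_const, conv_radLap_one] at h1
    simpa [conv] using h1
  · have hev : ∀ᶠ α in 𝓝[>] (0 : ℝ), |α ^ 2 * deriv φ α| < δ := by
      have := h.abs
      rw [abs_zero] at this
      exact this.eventually_lt_const hδ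
    obtain ⟨η, hη, hsub⟩ := mem_nhdsGT_iff_exists_Ioo_subset.1 hev
    have hη0 : (0 : ℝ) < η := hη
    -- Near y this gives α ≤ 2 √rho ≤ η / 2 < η.
    refine ⟨(η / 4) ^ 2, by positivity, fun x hx hxr ht => ?_⟩
    have hα := ang_mem_Ioo hx
    have hs : √(rho 1 x) ≤ η / 4 := Real.sqrt_le_iff.2 ⟨by positivity, hxr⟩
    have hm : |ang x 1 ^ 2 * deriv φ (ang x 1)| < δ :=
      hsub ⟨hα.1, by linarith [ang_lt_of_tau_pos ht]⟩
    rw [abs_mul, abs_of_nonneg (sq_nonneg _)] at hm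
    rw [abs_one, mul_one, ← sin_ang_sq, mul_comm]
    refine le_trans ?_ hm.le
    have h2 := Real.sin_le hα.1.le
    have h3 := (sin_pos_of_mem hα).le
    gcongr

/-- Green's formula is applied to f - f(y): its zero at y compensates for α² φ' being merely
bounded. The subtracted constant brings back f(y) ∫ ψ. -/
lemma IsKernelFun.conv_slap {f : S3 → ℝ} (hf : Smooth f) (y : S3) :
    conv φ (slap f) y = conv (radLap φ) f y + lapMass φ * f y := by
  have hfr := smooth_iff.1 hf
  have hfc := continuous_of_regAt hfr
  have hL := hφ.isC1Kernel_radLap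
  obtain ⟨C, hC0, hC⟩ := hφ.exists_bound
  have hg : Smooth fun x => f x - f y := smooth_iff.2 fun x => (hfr x).sub (regAt_const _ x)
  have hgc := continuous_of_regAt (smooth_iff.1 hg)
  have h1 := hφ.conv_radLap hg y (hφ.small_of_small_near hgc y fun δ hδ => ?_)
  · have hl : ∀ b, lder b (fun x => f x - f y) = lder b f := fun b => funext fun x => by
      rw [lder_sub b (by simp) (hfr x) (regAt_const _ x), lder_const, sub_zero]
    have hs : slap (fun x => f x - f y) = slap f := by
      funext x; simp only [slap, hl]
    rw [hs] at h1
    rw [← h1, conv]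
    have hi1 : Integrable (fun x => radLap φ (ang x y) * f x) surf := hL.integrable_mul hfc y
    have hi2 : Integrable (fun x => radLap φ (ang x y) * 1 * f y) surf :=
      Integrable.mul_const (hL.integrable_mul (f := fun _ => (1 : ℝ)) continuous_const y) _
    have : ∀ x, radLap φ (ang x y) * (f x - f y) =
        radLap φ (ang x y) * f x - radLap φ (ang x y) * 1 * f y := fun x => by ring
    simp only [this]
    rw [integral_sub hi1 hi2, integral_mul_const]
    have h2 := conv_radLap_one (φ := φ) y
    rw [conv] at h2 ⊢
    rw [h2]; ring
  · obtain ⟨η, hη, hc⟩ := Metric.continuousAt_iff.1 (hgc.continuousAt (x := y)) (δ / C)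
      (by positivity)
    refine ⟨(η / 2) ^ 2, by positivity, fun x hx hxr ht => ?_⟩
    have hd : dist x y < η := by
      rw [Subtype.dist_eq, dist_eq_norm]
      have hn := norm_sub_sq_real (x : ℍ[ℝ]) (y : ℍ[ℝ])
      rw [norm_coe, norm_coe] at hn
      change _ = 1 ^ 2 - 2 * tau y x + 1 ^ 2 at hn
      rw [rho] at hxr
      have : tau y x ≤ 1 := (le_abs_self _).trans (abs_tau_le y x)
      -- ‖x - y‖² = 2 (1 - τ) ≤ 2 (1 - τ²) because 0 < τ ≤ 1, and 1 - τ² ≤ η² / 4.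
      refine lt_of_pow_lt_pow_left₀ 2 hη.le ?_
      nlinarith
    have hgx := hc hd
    rw [sub_self, dist_zero_right, Real.norm_eq_abs] at hgx
    calc _ = |deriv φ (ang x y)| * rho y x * |f x - f y| := by ring
      _ ≤ C * (δ / C) := by
        gcongr
        exact deriv_mul_rho_le (fun α hα => (hC α hα).2) hx
      _ = δ := by field_simp

end KernelFun

/-! ### Smooth functions and the commutation relations of the frame. -/

section SmoothFun
variable {f g : S3 → ℝ}

lemma Smooth.add (hf : Smooth f) (hg : Smooth g) : Smooth fun x => f x + g x :=
  smooth_iff.2 fun x => (smooth_iff.1 hf x).add (smooth_iff.1 hg x)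

lemma Smooth.sub (hf : Smooth f) (hg : Smooth g) : Smooth fun x => f x - g x :=
  smooth_iff.2 fun x => (smooth_iff.1 hf x).sub (smooth_iff.1 hg x)

lemma Smooth.neg (hf : Smooth f) : Smooth fun x => - f x :=
  smooth_iff.2 fun x => (smooth_iff.1 hf x).neg

lemma Smooth.const_mul (hf : Smooth f) (c : ℝ) : Smooth fun x => c * f x :=
  smooth_iff.2 fun x => (regAt_const c x).mul (smooth_iff.1 hf x)

lemma Smooth.sum {w : Fin 3 → S3 → ℝ} (hw : ∀ a, Smooth (w a)) : Smooth fun x => ∑ a, w a x :=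
  smooth_iff.2 fun x => RegAt.sum fun a _ => smooth_iff.1 (hw a) x

lemma Smooth.lder (hf : Smooth f) (b : Fin 3) : Smooth (lder b f) :=
  smooth_iff.2 fun x => (smooth_iff.1 hf x).lder_infty b

lemma Smooth.slap (hf : Smooth f) : Smooth (slap f) :=
  Smooth.sum fun b => (hf.lder b).lder b

lemma Smooth.continuous (hf : Smooth f) : Continuous f := continuous_of_regAt (smooth_iff.1 hf)

lemma Smooth.lder_add (hf : Smooth f) (hg : Smooth g) (b : Fin 3) :
    SphereConv.lder b (fun x => f x + g x) =
      fun x => SphereConv.lder b f x + SphereConv.lder b g x :=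
  funext fun x => SphereConv.lder_add b (by simp) (smooth_iff.1 hf x) (smooth_iff.1 hg x)

lemma Smooth.lder_sub (hf : Smooth f) (hg : Smooth g) (b : Fin 3) :
    SphereConv.lder b (fun x => f x - g x) =
      fun x => SphereConv.lder b f x - SphereConv.lder b g x :=
  funext fun x => SphereConv.lder_sub b (by simp) (smooth_iff.1 hf x) (smooth_iff.1 hg x)

lemma Smooth.lder_neg (hf : Smooth f) (b : Fin 3) :
    SphereConv.lder b (fun x => - f x) = fun x => - SphereConv.lder b f x :=
  funext fun x => SphereConv.lder_neg b (by simp) (smooth_iff.1 hf x)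

lemma Smooth.lder_const_mul (hf : Smooth f) (c : ℝ) (b : Fin 3) :
    SphereConv.lder b (fun x => c * f x) = fun x => c * SphereConv.lder b f x :=
  funext fun x => by
    rw [SphereConv.lder_mul b (by simp) (regAt_const c x) (smooth_iff.1 hf x), lder_const,
      zero_mul, add_zero]

lemma Smooth.lder_sum {w : Fin 3 → S3 → ℝ} (hw : ∀ a, Smooth (w a)) (b : Fin 3) :
    SphereConv.lder b (fun x => ∑ a, w a x) = fun x => ∑ a, SphereConv.lder b (w a) x :=
  funext fun x => SphereConv.lder_sum b (n := ∞) (by simp) fun a _ => smooth_iff.1 (hw a) x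

lemma Smooth.regAt_two (hf : Smooth f) (x : S3) : RegAt 2 f x :=
  (smooth_iff.1 hf x).of_le (by norm_cast)

lemma Smooth.lder_comm_aux (hf : Smooth f) (x : S3) {a b c : Fin 3}
    (h : unit3 a * unit3 b - unit3 b * unit3 a = (2 : ℝ) • unit3 c) :
    SphereConv.lder a (SphereConv.lder b f) x - SphereConv.lder b (SphereConv.lder a f) x =
      2 * SphereConv.lder c f x := by
  rw [lder_lder_sub (hf.regAt_two x), h, mul_smul_comm, tderiv, map_smul, smul_eq_mul,
    SphereConv.lder, tderiv, frame]

lemma Smooth.comm01 (hf : Smooth f) (x : S3) : SphereConv.lder 0 (SphereConv.lder 1 f) x =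
    SphereConv.lder 1 (SphereConv.lder 0 f) x + 2 * SphereConv.lder 2 f x :=
  eq_add_of_sub_eq' (hf.lder_comm_aux x (by ext <;> simp; norm_num))

lemma Smooth.comm12 (hf : Smooth f) (x : S3) : SphereConv.lder 1 (SphereConv.lder 2 f) x =
    SphereConv.lder 2 (SphereConv.lder 1 f) x + 2 * SphereConv.lder 0 f x :=
  eq_add_of_sub_eq' (hf.lder_comm_aux x (by ext <;> simp; norm_num))

lemma Smooth.comm20 (hf : Smooth f) (x : S3) : SphereConv.lder 2 (SphereConv.lder 0 f) x =
    SphereConv.lder 0 (SphereConv.lder 2 f) x + 2 * SphereConv.lder 1 f x :=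
  eq_add_of_sub_eq' (hf.lder_comm_aux x (by ext <;> simp; norm_num))

end SmoothFun

/-! ### Vector calculus in the left-invariant frame. -/

/-- The field with the components `w` in the left-invariant frame. -/
def fld (w : Fin 3 → S3 → ℝ) (y : S3) : ℍ[ℝ] := ∑ a, w a y • frame a y

/-- The divergence in components. -/
def dv (w : Fin 3 → S3 → ℝ) (y : S3) : ℝ := ∑ a, lder a (w a) y

/-- The curl in components, without its term of order zero. -/
def rot (w : Fin 3 → S3 → ℝ) : Fin 3 → S3 → ℝ :=
  ![fun y => lder 1 (w 2) y - lder 2 (w 1) y, fun y => lder 2 (w 0) y - lder 0 (w 2) y,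
    fun y => lder 0 (w 1) y - lder 1 (w 0) y]

lemma inner_frame_frame (a b : Fin 3) (y : S3) :
    inner ℝ (frame a y) (frame b y) = if a = b then (1 : ℝ) else 0 := by
  rw [frame, frame, inner_mul_left]
  by_cases h : a = b
  · rw [h, real_inner_self_eq_norm_sq, norm_unit3]; simp
  · fin_cases a <;> fin_cases b <;> first | exact absurd rfl h | simp [Quaternion.inner_def]

lemma inner_coe_frame (a : Fin 3) (y : S3) : inner ℝ (y : ℍ[ℝ]) (frame a y) = (0 : ℝ) := by
  rw [frame, inner_coe_mul, re_unit3]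

lemma inner_frame_fld (a : Fin 3) (w : Fin 3 → S3 → ℝ) (y : S3) :
    inner ℝ (frame a y) (fld w y) = w a y := by
  simp [fld, inner_sum, inner_smul_right, inner_frame_frame]

lemma grad_eq_fld (f : S3 → ℝ) : grad f = fld fun a => lder a f := rfl

lemma fld_eq_of_tangent {v : ℍ[ℝ]} {y : S3} (h : inner ℝ (y : ℍ[ℝ]) v = (0 : ℝ)) :
    v = ∑ a, (inner ℝ (frame a y) v : ℝ) • frame a y := by
  conv_lhs => rw [frame_expansion y v, h, zero_smul, zero_add]

lemma cross_mul (y : S3) (p q : ℍ[ℝ]) : cross y (y * p) (y * q) = y * (p * q).im := by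
  rw [cross, inv_mul_cancel_left₀ (coe_ne_zero y), inv_mul_cancel_left₀ (coe_ne_zero y)]

lemma sum_smul_frame (c : Fin 3 → ℝ) (y : S3) :
    ∑ a, c a • frame a y = y * ∑ a, c a • unit3 a := by
  simp only [frame, Finset.mul_sum, mul_smul_comm]

lemma cross_sum_frame (y : S3) (c d : Fin 3 → ℝ) :
    cross y (∑ a, c a • frame a y) (∑ a, d a • frame a y) =
      ∑ a, (![c 1 * d 2 - c 2 * d 1, c 2 * d 0 - c 0 * d 2, c 0 * d 1 - c 1 * d 0] a : ℝ) •
        frame a y := by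
  rw [sum_smul_frame, sum_smul_frame, sum_smul_frame, cross_mul]
  congr 1
  simp only [Fin.sum_univ_three]
  ext <;> (simp; try ring)

lemma frame_eq_sum (b : Fin 3) (y : S3) :
    frame b y = ∑ a, (Pi.single b 1 : Fin 3 → ℝ) a • frame a y := by
  simp [Pi.single_apply]

section Field
variable {w : Fin 3 → S3 → ℝ} (hw : ∀ a, Smooth (w a))
include hw

lemma smooth_rot (c : Fin 3) : Smooth (rot w c) := by
  fin_cases c
  exacts [((hw 2).lder 1).sub ((hw 1).lder 2), ((hw 0).lder 2).sub ((hw 2).lder 0),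
    ((hw 1).lder 0).sub ((hw 0).lder 1)]

lemma smooth_dv : Smooth (dv w) := Smooth.sum fun a => (hw a).lder a

lemma isSmoothField_fld : IsSmoothField (fld w) where
  smooth := smooth_iff.2 fun x => RegAt.sum fun a _ =>
    (smooth_iff.1 (hw a) x).smul (regAt_frame a x)
  tangent := fun x => by simp [fld, inner_sum, inner_smul_right, inner_coe_frame]

lemma tderiv_fld (b : Fin 3) (y : S3) :
    tderiv (fld w) y (frame b y) =
      ∑ a, (w a y • ((y : ℍ[ℝ]) * (unit3 b * unit3 a)) + lder b (w a) y • frame a y) := by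
  change lder b (fun x => ∑ a, w a x • frame a x) y = _
  rw [lder_sum b (n := ∞) (by simp) fun a _ => (smooth_iff.1 (hw a) y).smul (regAt_frame a y)]
  refine Finset.sum_congr rfl fun a _ => ?_
  rw [lder_smul b (n := ∞) (by simp) (smooth_iff.1 (hw a) y) (regAt_frame a y), lder_frame]

/-- The Levi-Civita connection in the left-invariant frame. -/
lemma covDeriv_fld (b : Fin 3) (y : S3) :
    covDeriv (fld w) y (frame b y) = ∑ a, lder b (w a) y • frame a y +
      cross y (frame b y) (fld w y) := by
  have h1 : tderiv (fld w) y (frame b y) = (y : ℍ[ℝ]) * (unit3 b * ∑ a, w a y • unit3 a) +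
      ∑ a, lder b (w a) y • frame a y := by
    rw [tderiv_fld hw, Finset.sum_add_distrib]
    simp only [Finset.mul_sum, mul_smul_comm]
  have h3 : inner ℝ (y : ℍ[ℝ]) (∑ a, lder b (w a) y • frame a y) = (0 : ℝ) := by
    simp [inner_sum, inner_smul_right, inner_coe_frame]
  rw [covDeriv, h1, inner_add_right, h3, add_zero, inner_coe_mul, fld,
    sum_smul_frame (fun a => lder b (w a) y), sum_smul_frame (fun a => w a y), frame, cross_mul]
  set p := unit3 b * ∑ a, w a y • unit3 a
  -- The normal part of y * p is y times the real part of p; removing it leaves y times the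
  -- imaginary part, which is the cross product.
  have h4 : p.re • (y : ℍ[ℝ]) = y * (p.re : ℍ[ℝ]) := by
    rw [Quaternion.mul_coe_eq_smul]
  rw [h4]
  nth_rewrite 1 [← Quaternion.re_add_im p]
  rw [mul_add]
  abel

lemma covDeriv_fld_eq_sum (b : Fin 3) (y : S3) :
    covDeriv (fld w) y (frame b y) = ∑ a, (lder b (w a) y +
      (let c : Fin 3 → ℝ := Pi.single b 1
      ![c 1 * w 2 y - c 2 * w 1 y, c 2 * w 0 y - c 0 * w 2 y, c 0 * w 1 y - c 1 * w 0 y] a : ℝ)) •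
        frame a y := by
  rw [covDeriv_fld hw, frame_eq_sum b, fld, cross_sum_frame, ← Finset.sum_add_distrib]
  simp only [add_smul]

/-- The connection term E_b × W is orthogonal to E_b, so the divergence has no term of order zero.
-/
lemma divg_fld (y : S3) : divg (fld w) y = dv w y := by
  refine Finset.sum_congr rfl fun b _ => ?_
  rw [covDeriv_fld_eq_sum hw]
  simp only [inner_sum, inner_smul_right, inner_frame_frame]
  fin_cases b <;> simp

/-- The connection term contributes Σ E_b × (E_b × W) = -2W. -/
lemma curl_fld : curl (fld w) = fld fun a y => rot w a y - 2 * w a y := by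
  funext y
  have h : ∀ b, cross y (frame b y) (covDeriv (fld w) y (frame b y)) = _ := fun b => by
    rw [covDeriv_fld_eq_sum hw, frame_eq_sum b, cross_sum_frame]
  simp only [curl, h]
  rw [Finset.sum_comm]
  simp only [← Finset.sum_smul]
  refine Finset.sum_congr rfl fun a _ => ?_
  congr 1
  fin_cases a <;> simp [Fin.sum_univ_three, rot] <;> ring

lemma rot_sub_two_mul (a : Fin 3) (y : S3) :
    rot (fun a y => rot w a y - 2 * w a y) a y = rot (rot w) a y - 2 * rot w a y := by
  have h : ∀ a b, lder b (fun y => rot w a y - 2 * w a y) =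
      fun y => lder b (rot w a) y - 2 * lder b (w a) y := fun a b => by
    rw [(smooth_rot hw a).lder_sub ((hw a).const_mul 2), (hw a).lder_const_mul]
  fin_cases a
  · change lder 1 (fun y => rot w 2 y - 2 * w 2 y) y - lder 2 (fun y => rot w 1 y - 2 * w 1 y) y =
      lder 1 (rot w 2) y - lder 2 (rot w 1) y - 2 * (lder 1 (w 2) y - lder 2 (w 1) y)
    rw [h, h]; ring
  · change lder 2 (fun y => rot w 0 y - 2 * w 0 y) y - lder 0 (fun y => rot w 2 y - 2 * w 2 y) y =
      lder 2 (rot w 0) y - lder 0 (rot w 2) y - 2 * (lder 2 (w 0) y - lder 0 (w 2) y)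
    rw [h, h]; ring
  · change lder 0 (fun y => rot w 1 y - 2 * w 1 y) y - lder 1 (fun y => rot w 0 y - 2 * w 0 y) y =
      lder 0 (rot w 1) y - lder 1 (rot w 0) y - 2 * (lder 0 (w 1) y - lder 1 (w 0) y)
    rw [h, h]; ring

lemma rot_neg (a : Fin 3) (y : S3) : rot (fun a y => - w a y) a y = - rot w a y := by
  have h : ∀ a b, lder b (fun y => - w a y) = fun y => - lder b (w a) y := fun a b =>
    (hw a).lder_neg b
  fin_cases a
  · change lder 1 (fun y => - w 2 y) y - lder 2 (fun y => - w 1 y) y =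
      - (lder 1 (w 2) y - lder 2 (w 1) y)
    rw [h, h]; ring
  · change lder 2 (fun y => - w 0 y) y - lder 0 (fun y => - w 2 y) y =
      - (lder 2 (w 0) y - lder 0 (w 2) y)
    rw [h, h]; ring
  · change lder 0 (fun y => - w 1 y) y - lder 1 (fun y => - w 0 y) y =
      - (lder 0 (w 1) y - lder 1 (w 0) y)
    rw [h, h]; ring

lemma lder_dv (c : Fin 3) (y : S3) : lder c (dv w) y = ∑ a, lder c (lder a (w a)) y := by
  change lder c (fun y => ∑ a, lder a (w a) y) y = _
  rw [Smooth.lder_sum fun a => (hw a).lder a]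

lemma lder_rot (c : Fin 3) :
    (lder c (rot w 0) = fun y => lder c (lder 1 (w 2)) y - lder c (lder 2 (w 1)) y) ∧
    (lder c (rot w 1) = fun y => lder c (lder 2 (w 0)) y - lder c (lder 0 (w 2)) y) ∧
    (lder c (rot w 2) = fun y => lder c (lder 0 (w 1)) y - lder c (lder 1 (w 0)) y) :=
  ⟨((hw 2).lder 1).lder_sub ((hw 1).lder 2) c, ((hw 0).lder 2).lder_sub ((hw 2).lder 0) c,
    ((hw 1).lder 0).lder_sub ((hw 0).lder 1) c⟩

/-- The flat identity curl curl = grad div - Δ, corrected by 2 `rot` because mixed derivatives no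
longer commute. -/
lemma rot_rot (a : Fin 3) (y : S3) :
    rot (rot w) a y = lder a (dv w) y + 2 * rot w a y - slap (w a) y := by
  rw [lder_dv hw, slap, Fin.sum_univ_three, Fin.sum_univ_three]
  fin_cases a
  · change lder 1 (rot w 2) y - lder 2 (rot w 1) y = _ + 2 * (lder 1 (w 2) y - lder 2 (w 1) y) - _
    simp only [(lder_rot hw _).2.1, (lder_rot hw _).2.2, Fin.zero_eta]
    rw [(hw 1).comm01, ← sub_eq_of_eq_add ((hw 2).comm20 y)]
    ring
  · change lder 2 (rot w 0) y - lder 0 (rot w 2) y = _ + 2 * (lder 2 (w 0) y - lder 0 (w 2) y) - _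
    simp only [(lder_rot hw _).1, (lder_rot hw _).2.2, Fin.mk_one]
    rw [(hw 2).comm12, ← sub_eq_of_eq_add ((hw 0).comm01 y)]
    ring
  · change lder 0 (rot w 1) y - lder 1 (rot w 0) y = _ + 2 * (lder 0 (w 1) y - lder 1 (w 0) y) - _
    simp only [(lder_rot hw _).1, (lder_rot hw _).2.1, Fin.reduceFinMk]
    rw [(hw 0).comm20, ← sub_eq_of_eq_add ((hw 1).comm12 y)]
    ring

/-- -(rot - 2)² + grad div, with rot rot eliminated by `rot_rot`. -/
lemma vlap_fld (y : S3) :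
    vlap (fld w) y = ∑ a, (slap (w a) y + 2 * rot w a y - 4 * w a y) • frame a y := by
  have hc : ∀ a, Smooth fun y => rot w a y - 2 * w a y := fun a =>
    (smooth_rot hw a).sub ((hw a).const_mul 2)
  have hd : divg (fld w) = dv w := funext (divg_fld hw)
  rw [vlap, curl_fld hw, curl_fld hc, hd, grad_eq_fld, fld, fld, ← Finset.sum_neg_distrib,
    ← Finset.sum_add_distrib]
  refine Finset.sum_congr rfl fun a _ => ?_
  rw [← neg_smul, ← add_smul, rot_sub_two_mul hw, rot_rot hw]
  congr 1
  ring

end Field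

/-! ### The Casimir operator and the vector Laplacian of gradients and of rot. -/

section Slap
variable {f g : S3 → ℝ}

lemma slap_sub (hf : Smooth f) (hg : Smooth g) (y : S3) :
    slap (fun x => f x - g x) y = slap f y - slap g y := by
  simp only [slap, hf.lder_sub hg, (hf.lder _).lder_sub (hg.lder _), Finset.sum_sub_distrib]

lemma slap_neg (hf : Smooth f) (y : S3) : slap (fun x => - f x) y = - slap f y := by
  simp only [slap, hf.lder_neg, (hf.lder _).lder_neg, Finset.sum_neg_distrib]

lemma slap_sum {w : Fin 3 → S3 → ℝ} (hw : ∀ a, Smooth (w a)) (y : S3) :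
    slap (fun x => ∑ a, w a x) y = ∑ a, slap (w a) y := by
  simp only [slap, Smooth.lder_sum hw, Smooth.lder_sum fun a => (hw a).lder _]
  exact Finset.sum_comm

lemma lder_congr_comm (hf : Smooth f) {a b c : Fin 3}
    (h : ∀ x, lder a (lder b f) x = lder b (lder a f) x + 2 * lder c f x) (d : Fin 3) (y : S3) :
    lder d (lder a (lder b f)) y = lder d (lder b (lder a f)) y + 2 * lder d (lder c f) y := by
  rw [show lder a (lder b f) = _ from funext h,
    ((hf.lder a).lder b).lder_add ((hf.lder c).const_mul 2), (hf.lder c).lder_const_mul]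

/-- The Casimir operator commutes with the left-invariant fields. -/
lemma slap_lder (hf : Smooth f) (a : Fin 3) (y : S3) : slap (lder a f) y = lder a (slap f) y := by
  have h1 : lder a (slap f) y = ∑ b, lder a (lder b (lder b f)) y := by
    change lder a (fun x => ∑ b, lder b (lder b f) x) y = _
    rw [Smooth.lder_sum fun b => (hf.lder b).lder b]
  rw [h1, slap, Fin.sum_univ_three, Fin.sum_univ_three]
  have h01 := lder_congr_comm hf hf.comm01
  have h12 := lder_congr_comm hf hf.comm12
  have h20 := lder_congr_comm hf hf.comm20
  have k01 := fun b => (hf.lder b).comm01 y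
  have k12 := fun b => (hf.lder b).comm12 y
  have k20 := fun b => (hf.lder b).comm20 y
  fin_cases a <;> simp only [Fin.zero_eta, Fin.mk_one, Fin.reduceFinMk]
  -- [E_b², E_a] = E_b [E_b, E_a] + [E_b, E_a] E_b, and the sum over b cancels. The relations k
  -- exchange the outer two derivatives, the relations h the inner two.
  · linear_combination k20 2 + h20 2 y - k01 1 - h01 1 y
  · linear_combination k01 0 + h01 0 y - k12 2 - h12 2 y
  · linear_combination k12 1 + h12 1 y - k20 0 - h20 0 y

lemma rot_grad (hf : Smooth f) (a : Fin 3) (y : S3) :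
    rot (fun a => lder a f) a y = 2 * lder a f y := by
  fin_cases a
  · exact sub_eq_of_eq_add' (hf.comm12 y)
  · exact sub_eq_of_eq_add' (hf.comm20 y)
  · exact sub_eq_of_eq_add' (hf.comm01 y)

/-- On gradients rot is multiplication by 2, so the lower-order terms 2 rot - 4 cancel. -/
lemma vlap_grad (hf : Smooth f) (y : S3) : vlap (grad f) y = grad (slap f) y := by
  rw [grad_eq_fld, vlap_fld fun a => hf.lder a, grad_eq_fld, fld]
  refine Finset.sum_congr rfl fun a _ => ?_
  rw [rot_grad hf, slap_lder hf]
  congr 1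
  ring

lemma slap_dv {w : Fin 3 → S3 → ℝ} (hw : ∀ a, Smooth (w a)) :
    slap (dv w) = dv fun a => slap (w a) := by
  funext y
  change slap (fun y => ∑ a, lder a (w a) y) y = _
  rw [slap_sum fun a => (hw a).lder a]
  exact Finset.sum_congr rfl fun a _ => slap_lder (hw a) a y

lemma slap_rot {w : Fin 3 → S3 → ℝ} (hw : ∀ a, Smooth (w a)) (a : Fin 3) (y : S3) :
    slap (rot w a) y = rot (fun a => slap (w a)) a y := by
  fin_cases a
  · refine (slap_sub ((hw 2).lder 1) ((hw 1).lder 2) y).trans ?_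
    rw [slap_lder (hw 2), slap_lder (hw 1)]; rfl
  · refine (slap_sub ((hw 0).lder 2) ((hw 2).lder 0) y).trans ?_
    rw [slap_lder (hw 0), slap_lder (hw 2)]; rfl
  · refine (slap_sub ((hw 1).lder 0) ((hw 0).lder 1) y).trans ?_
    rw [slap_lder (hw 1), slap_lder (hw 0)]; rfl

/-- The term -2 rot rot w, expanded by `rot_rot`, produces the Casimir and gradient terms, and its
-4 rot w cancels the zero-order term. -/
lemma vlap_fld_neg_rot {w : Fin 3 → S3 → ℝ} (hw : ∀ a, Smooth (w a)) (y : S3) :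
    vlap (fld fun a y => - rot w a y) y =
      fld (fun a y => - rot (fun a => slap (w a)) a y) y +
        (2 : ℝ) • fld (fun a => slap (w a)) y - (2 : ℝ) • grad (dv w) y := by
  rw [vlap_fld fun a => (smooth_rot hw a).neg, grad_eq_fld, fld, fld, fld, Finset.smul_sum,
    Finset.smul_sum, ← Finset.sum_add_distrib, ← Finset.sum_sub_distrib]
  refine Finset.sum_congr rfl fun a _ => ?_
  rw [smul_smul, smul_smul, ← add_smul, ← sub_smul, slap_neg (smooth_rot hw a), slap_rot hw,
    rot_neg (smooth_rot hw), rot_rot hw]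
  congr 1
  ring

lemma lap_eq_slap (hf : Smooth f) : lap f = slap f := by
  funext y
  rw [lap, grad_eq_fld, divg_fld fun a => hf.lder a]
  rfl

end Slap

/-! ### The convolutions A, B and g in components. -/

lemma pair_eq (K : Kernel) (f : S3 → ℝ) (y : S3) : pair K f y = conv K.fn f y + K.mass * f y := rfl

/-- The components of a field in the left-invariant frame. -/
def comp (V : S3 → ℍ[ℝ]) (a : Fin 3) (x : S3) : ℝ := inner ℝ (frame a x) (V x)

lemma grad_eq_sum (f : S3 → ℝ) (y : S3) : grad f y = ∑ a, lder a f y • frame a y := rfl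

lemma inner_sum_frame (c d : Fin 3 → ℝ) (y : S3) :
    inner ℝ (∑ a, c a • frame a y) (∑ a, d a • frame a y) = ∑ a, c a * d a := by
  simp [sum_inner, inner_sum, inner_smul_left, inner_smul_right, inner_frame_frame, mul_comm]

section Pair
variable {K : Kernel} (hK : IsC1Kernel K.fn) {f : S3 → ℝ}
include hK

lemma smooth_pair (hf : Smooth f) : Smooth (pair K f) :=
  (hK.smooth_conv hf).add (hf.const_mul K.mass)

lemma lder_pair (hf : Smooth f) (b : Fin 3) : lder b (pair K f) = pair K (lder b f) := by
  change lder b (fun y => conv K.fn f y + K.mass * f y) = _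
  rw [(hK.smooth_conv hf).lder_add (hf.const_mul K.mass), hf.lder_const_mul, hK.lder_conv hf]
  rfl

lemma slap_pair (hf : Smooth f) (y : S3) : slap (pair K f) y = pair K (slap f) y := by
  have hfb : ∀ b, Continuous (lder b (lder b f)) := fun b => ((hf.lder b).lder b).continuous
  have h1 : ∀ b, Integrable (fun x => K.fn (ang x y) * lder b (lder b f) x) surf := fun b =>
    hK.integrable_mul (hfb b) y
  simp only [slap, lder_pair hK hf, lder_pair hK (hf.lder _), pair_eq, conv, Finset.mul_sum]
  rw [integral_finsetSum _ fun b _ => h1 b, Finset.sum_add_distrib]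

end Pair

section Field
variable {V : S3 → ℍ[ℝ]} (hV : IsSmoothField V)
include hV

lemma smooth_comp (a : Fin 3) : Smooth (comp V a) :=
  smooth_iff.2 fun x => (regAt_frame a x).inner (smooth_iff.1 hV.smooth x)

/-- y x⁻¹ (x e_a) = y e_a: left translation keeps the components and replaces the frame at x by the
one at y. -/
lemma transl_eq (x y : S3) : transl x y (V x) = ∑ a, comp V a x • frame a y := by
  conv_lhs => rw [fld_eq_of_tangent (hV.tangent x)]
  rw [transl, Finset.mul_sum]
  refine Finset.sum_congr rfl fun a _ => ?_
  rw [mul_smul_comm, frame, mul_assoc, inv_mul_cancel_left₀ (coe_ne_zero x)]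
  rfl

/-- The frame stays fixed at y while x varies, so only the components are differentiated and no
connection term appears. -/
lemma tderiv_transl (y : S3) (b : Fin 3) :
    tderiv (fun x => transl x y (V x)) y (frame b y) = ∑ a, lder b (comp V a) y • frame a y := by
  simp only [transl_eq hV]
  change lder b (fun x => ∑ a, comp V a x • frame a y) y = _
  have h : ∀ a, RegAt ∞ (comp V a) y := fun a => smooth_iff.1 (smooth_comp hV a) y
  rw [lder_sum b (n := ∞) (by simp) fun a _ => (h a).smul (regAt_const _ y)]
  refine Finset.sum_congr rfl fun a _ => ?_
  rw [lder_smul b (n := ∞) (by simp) (h a) (regAt_const _ y), lder_const, smul_zero, zero_add]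

variable {K : Kernel} (hK : IsC1Kernel K.fn)
include hK

lemma convA_eq : convA V K = fld fun a => pair K (comp V a) := by
  funext y
  have hc := fun a => (smooth_comp hV a).continuous
  have h : ∀ x, K.fn (ang x y) • transl x y (V x) =
      ∑ a, (K.fn (ang x y) * comp V a x) • frame a y := fun x => by
    rw [transl_eq hV, Finset.smul_sum]
    simp only [smul_smul]
  have hi : ∀ a, Integrable (fun x => K.fn (ang x y) * comp V a x) surf := fun a =>
    hK.integrable_mul (hc a) y
  rw [convA]
  simp only [h]
  rw [integral_finsetSum _ fun a _ => (hi a).smul_const _]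
  simp only [integral_smul_const]
  conv_lhs => rw [fld_eq_of_tangent (hV.tangent y)]
  rw [Finset.smul_sum, ← Finset.sum_add_distrib]
  refine Finset.sum_congr rfl fun a _ => ?_
  rw [smul_smul, ← add_smul]
  rfl

lemma convg_eq : convg V K = dv fun a => pair K (comp V a) := by
  funext y
  have hc := fun a => (smooth_comp hV a).continuous
  rw [convg]
  simp only [transl_eq hV, grad_eq_sum, inner_sum_frame]
  rw [integral_finsetSum _ fun a _ => hK.integrable_mul_lder_right (hc a) a y, Finset.mul_sum,
    ← Finset.sum_add_distrib]
  refine Finset.sum_congr rfl fun a _ => ?_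
  rw [hK.integral_mul_lder_right (smooth_comp hV a), lder_pair hK (smooth_comp hV a), pair_eq]
  congr 2
  simp only [← transl_eq hV]
  rw [tderiv_transl hV, real_inner_comm]
  exact inner_frame_fld a (fun c => lder a (comp V c)) y

/-- In V × ∇φ the derivative stands on the second factor; moved onto V, it yields the curl
expression with the opposite sign. The mass term has the same shape, since convolution commutes with
the frame derivatives. -/
lemma convB_eq : convB V K = fld fun a y => - rot (fun a => pair K (comp V a)) a y := by
  funext y
  have hs := smooth_comp hV
  have hi : ∀ a b, Integrable (fun x => comp V a x * lder b (fun z => K.fn (ang x z)) y) surf :=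
    fun a b => hK.integrable_mul_lder_right (hs a).continuous b y
  set I : Fin 3 → S3 → ℝ := fun a x =>
    (let d : Fin 3 → ℝ := fun b => lder b (fun z => K.fn (ang x z)) y
    ![comp V 1 x * d 2 - comp V 2 x * d 1, comp V 2 x * d 0 - comp V 0 x * d 2,
      comp V 0 x * d 1 - comp V 1 x * d 0] a) with hI
  have h : ∀ x, cross y (transl x y (V x)) (grad (fun z => K.fn (ang x z)) y) =
      ∑ a, I a x • frame a y := fun x => by
    rw [transl_eq hV, grad_eq_sum, cross_sum_frame]
  have hIi : ∀ a, Integrable (I a) surf := fun a => by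
    fin_cases a
    exacts [(hi 1 2).sub (hi 2 1), (hi 2 0).sub (hi 0 2), (hi 0 1).sub (hi 1 0)]
  have hsub : ∀ a b c d, ∫ x, (comp V a x * lder b (fun z => K.fn (ang x z)) y -
      comp V c x * lder d (fun z => K.fn (ang x z)) y) ∂surf =
      conv K.fn (lder b (comp V a)) y - conv K.fn (lder d (comp V c)) y := fun a b c d => by
    rw [integral_sub (hi a b) (hi c d), hK.integral_mul_lder_right (hs a),
      hK.integral_mul_lder_right (hs c)]
  have hm : ∀ b, cross y (tderiv (fun x => transl x y (V x)) y (frame b y)) (frame b y) =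
      ∑ a, (let c : Fin 3 → ℝ := fun a => lder b (comp V a) y
        let d : Fin 3 → ℝ := Pi.single b 1
        ![c 1 * d 2 - c 2 * d 1, c 2 * d 0 - c 0 * d 2, c 0 * d 1 - c 1 * d 0] a : ℝ) •
          frame a y := fun b => by
    conv_lhs => rw [tderiv_transl hV]; arg 3; rw [frame_eq_sum b]
    rw [cross_sum_frame]
  rw [convB]
  simp only [h, hm]
  rw [integral_finsetSum _ fun a _ => (hIi a).smul_const _, Finset.sum_comm]
  simp only [integral_smul_const, ← Finset.sum_smul]
  rw [Finset.smul_sum, ← Finset.sum_add_distrib]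
  refine Finset.sum_congr rfl fun a _ => ?_
  rw [smul_smul, ← add_smul]
  congr 1
  fin_cases a
  · refine (congrArg (· + _) (hsub 1 2 2 1)).trans ?_
    simp [Fin.sum_univ_three, rot, lder_pair hK (hs _), pair_eq]
    ring
  · refine (congrArg (· + _) (hsub 2 0 0 2)).trans ?_
    simp [Fin.sum_univ_three, rot, lder_pair hK (hs _), pair_eq]
    ring
  · refine (congrArg (· + _) (hsub 0 1 1 0)).trans ?_
    simp [Fin.sum_univ_three, rot, lder_pair hK (hs _), pair_eq]
    ring

end Field

end SphereConv

end

/-! ### The three identities. -/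

open SphereConv in
theorem proposition2 (V : S3 → ℍ[ℝ]) (hV : IsSmoothField V) (φ : ℝ → ℝ) (hφ : IsKernelFun φ) :
    ∃ c : ℝ,
      IsLaplacian (Kernel.ofFun φ) ⟨radLap φ, c⟩ ∧
      (Tendsto (fun α : ℝ => α ^ 2 * deriv φ α) (𝓝[>] 0) (𝓝 0) → c = 0) ∧
      IsSmoothField (convA V (Kernel.ofFun φ)) ∧
      IsSmoothField (convB V (Kernel.ofFun φ)) ∧
      Smooth (convg V (Kernel.ofFun φ)) ∧
      Smooth (convg V ⟨radLap φ, c⟩) ∧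
      ∀ y : S3,
        vlap (convA V (Kernel.ofFun φ)) y =
          convA V ⟨radLap φ, c⟩ y - (4 : ℝ) • convA V (Kernel.ofFun φ) y
            - (2 : ℝ) • convB V (Kernel.ofFun φ) y ∧
        vlap (convB V (Kernel.ofFun φ)) y =
          convB V ⟨radLap φ, c⟩ y + (2 : ℝ) • convA V ⟨radLap φ, c⟩ y
            - (2 : ℝ) • convG V (Kernel.ofFun φ) y ∧
        vlap (convG V (Kernel.ofFun φ)) y = convG V ⟨radLap φ, c⟩ y := by
  have hK : IsC1Kernel (Kernel.ofFun φ).fn := hφ.isC1Kernel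
  have hL : IsC1Kernel (⟨radLap φ, lapMass φ⟩ : Kernel).fn := hφ.isC1Kernel_radLap
  have hpair : ∀ f : S3 → ℝ, Smooth f →
      pair (Kernel.ofFun φ) (slap f) = pair ⟨radLap φ, lapMass φ⟩ f := fun f hf =>
    funext fun y => by
    rw [pair_eq, pair_eq]
    simp only [Kernel.ofFun, zero_mul, add_zero]
    exact hφ.conv_slap hf y
  have hc := smooth_comp hV
  set w : Fin 3 → S3 → ℝ := fun a => pair (Kernel.ofFun φ) (comp V a) with hw
  have hws : ∀ a, Smooth (w a) := fun a => smooth_pair hK (hc a)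
  -- The components of A(V, Δφ) are the Casimir operator applied to those of A(V, φ); this is all
  -- that the identities need to know about Δφ.
  have hW : (fun a => pair ⟨radLap φ, lapMass φ⟩ (comp V a)) = fun a => slap (w a) :=
    funext fun a => by
      rw [← hpair _ (hc a)]
      exact funext fun y => (slap_pair hK (hc a) y).symm
  have hA := convA_eq hV hK
  have hA' := convA_eq hV hL
  have hB := convB_eq hV hK
  have hB' := convB_eq hV hL
  have hg := convg_eq hV hK
  have hg' := convg_eq hV hL
  simp only [hW] at hA' hB' hg'
  refine ⟨lapMass φ, fun f hf y => ?_, hφ.lapMass_eq_zero, ?_, ?_, ?_, ?_, fun y => ⟨?_, ?_, ?_⟩⟩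
  · rw [lap_eq_slap hf, hpair f hf]
  · rw [hA]; exact isSmoothField_fld hws
  · rw [hB]; exact isSmoothField_fld fun a => (smooth_rot hws a).neg
  · rw [hg]; exact smooth_dv hws
  · rw [hg']; exact smooth_dv fun a => (hws a).slap
  · rw [hA, hA', hB, vlap_fld hws, fld, fld, fld, Finset.smul_sum, Finset.smul_sum,
      ← Finset.sum_sub_distrib, ← Finset.sum_sub_distrib]
    refine Finset.sum_congr rfl fun a _ => ?_
    rw [smul_smul, smul_smul, ← sub_smul, ← sub_smul]
    congr 1
    ring
  · rw [hB, hB', hA', vlap_fld_neg_rot hws]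
    unfold convG
    rw [hg]
  · unfold convG
    rw [hg, hg', vlap_grad (smooth_dv hws), slap_dv hws]
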